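/- **Setting.** Consider $\min f(x)$ subject to $h(x)=0$, $c(x)\le 0$, with $f:\mathbb R^n\to\mathbb R$, $h:\mathbb R^n\to\mathbb R^{m_1}$, $c:\mathbb R^n\to\mathbb R^{m_2}$ continuously differentiable; $\|\cdot\|$ is the Euclidean norm. Let $K_0=\{0\}\times\mathbb R_-^{m_2}$ and $$\phi(x)=\mathrm{dist}_\infty\big((h(x),c(x))\mid K_0\big),\qquad \Psi(x;\rho)=f(x)+\rho\,\phi(x),$$ $$\kappa(x,\sigma)=\inf_{\|p\|_\infty\le\sigma}\mathrm{dist}_\infty\big((h(x)+\nabla h(x)^Tp,\;c(x)+\nabla c(x)^Tp)\mid K_0\big),\qquad \Delta_\phi(x,\sigma)=\phi(x)-\kappa(x,\sigma),$$ $$\chi(x)=-\min\{\nabla f(x)^Tt:\ \nabla h(x)^Tt=0,\ \nabla c(x)^Tt\le0,\ \|t\|_\infty\le\tfrac12\beta_l\}.$$ **Algorithm.** Parameters: $0<2\sigma_u<\beta_l<\beta_u$, $\kappa_u>0$, $\gamma>1$, $\theta\in(0,1)$, $\alpha_{\max}>0$, $\alpha_0=\gamma^{-j_0}\alpha_{\max}$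 with an integer $j_0\geq 1$, $\zeta_0,\zeta_c>0$, $\rho_0>0$, $p_0^g$, and an increasing sequence $a_j\in(0,1]$ with $a_0\ge p_0^g$ and $\sum_j(1-a_j)<\infty$. At iteration $k$, with $\sigma_k=\min\{\sigma_u,\kappa_u\phi(x_k)\}$, $\kappa_k=\kappa(x_k,\sigma_k)$, some $\beta_k\in[\beta_l,\beta_u]$, a matrix $H_k$ and a random estimate $g_k$ of $\nabla f(x_k)$, let $d_k$ minimize $g_k^Td+\frac12d^TH_kd$ subject to $-\kappa_ke\le h(x_k)+\nabla h(x_k)^Td\le\kappa_ke$, $c(x_k)+\nabla c(x_k)^Td\le\kappa_ke$, $\|d\|_\infty\le\beta_k$. If $\|g_k\|>\zeta_k$, set $\zeta_{k+1}=\max\{\zeta_k+\zeta_c,\|g_k\|\}$ and let $p^g_{k+1}$ be the next $a_j$ (starting with $a_1$); otherwise keep $\zeta_k$ and $p^g_k$. Put $\Delta_k(\rho)=-g_k^Td_k+\rho\,\Delta_\phi(x_k,\sigma_k)$. If $\Delta_k(\rho_k)\ge\frac12d_k^TH_kd_k$ then $\rho_{k+1}=\rho_k$, otherwise $\rho_{k+1}=\max\{(g_k^Td_k+\frac12d_k^TH_kd_k)/\Delta_\phi(x_k,\sigma_k),\,2\rho_k\}$.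 With random estimates $f_k^0$ of $f(x_k)$ and $f_k^s$ of $f(x_k+\alpha_kd_k)$, the step is successful if $$f_k^0+\rho_{k+1}\phi(x_k)-f_k^s-\rho_{k+1}\phi(x_k+\alpha_kd_k)\ge\theta\alpha_k\Delta_k(\rho_{k+1});$$ then $x_{k+1}=x_k+\alpha_kd_k$ and $\alpha_{k+1}=\min\{\gamma\alpha_k,\alpha_{\max}\}$. Otherwise $x_{k+1}=x_k$ and $\alpha_{k+1}=\gamma^{-1}\alpha_k$. Let $\mathcal F_{k-1}$ be the $\sigma$-algebra generated by $g_i,f_i^0,f_i^s$ $(i<k)$, and $\mathcal F_{k-1/2}$ the one generated by $\mathcal F_{k-1}$ and $g_k$; $d_k$ is $\mathcal F_{k-1/2}$-measurable. **Assumptions.** 1. A bounded closed set $\Omega$ contains all iterates $x_k$ and trial points $x_k+\alpha d_k$, $0\le\alpha\le\alpha_k$. On $\Omega$ the gradients $\nabla f,\nabla h_i,\nabla c_i$ are Lipschitz with constants $L_f,L_{h,i},L_{c,i}$; $L_{hc}$ is the maximum of the $L_{h,i}$ and $L_{c,i}$. For constants $\xi,M_H>0$, $2\xi\|d\|^2\le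 d^TH_kd\le M_H\|d\|^2$ for all $d$ and $k$. 2. $\Pr(\|g_k-\nabla f(x_k)\|\le\kappa_g\alpha_k\|d_k\|\mid\mathcal F_{k-1})\ge p_k^g$ and $\Pr(|f_k^0-f(x_k)|\le\varepsilon_f\alpha_k^2\|d_k\|^2,\ |f_k^s-f(x_k+\alpha_kd_k)|\le\varepsilon_f\alpha_k^2\|d_k\|^2\mid\mathcal F_{k-1/2})\ge p_f$, where $\kappa_g>0$ and $0<\varepsilon_f<\frac{\xi\theta}{4\alpha_{\max}}$. 3. The extended MFCQ holds at every point $x$ of a closed set $K\subseteq\Omega$ that contains all iterates (for instance the closure of the set of all iterates): the $\nabla h_i(x)$ are linearly independent, and there is $z$ with $\nabla h(x)^Tz=0$ and $\nabla c_i(x)^Tz<0$ whenever $c_i(x)\ge0$. 4. $\mathbf E[|f_k^s-f(x_k+\alpha_kd_k)|^2\mid\mathcal F_{k-1/2}]$ and $\mathbf E[|f_k^0-f(x_k)|^2\mid\mathcal F_{k-1/2}]$ are at most $\kappa_f^2\alpha_k^2(\phi(x_k)^2+\chi(x_k)^2)^2$, where $\kappa_f>0$. 5. (Bounded regime.) $\zeta_k=\zeta_0$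 and $p_k^g=p_g$ for all $k$ (in particular $\|g_k\|\le\zeta_0$), and the penalty parameter starts at $\rho_0=\bar\rho$. **Theorem.** There is $\rho_*>0$ such that for every $\bar\rho>\rho_*$ there is $\nu_*\in(0,1)$ such that the following holds for every $\nu\in[\nu_*,1)$; here $\rho_*$ and $\nu_*$ depend only on the problem, $\Omega$, $K$, the Lipschitz constants, the algorithm parameters $\sigma_u,\kappa_u,\beta_l,\beta_u,\gamma,\theta,\alpha_{\max},j_0,\zeta_0,\zeta_c$ and $\xi,M_H,\kappa_g,\varepsilon_f$, and $\nu_*$ also on $\bar\rho$. Let $p_f,p_g\in(0,1]$ satisfy $$p_g\ge\frac{2\gamma-1}{2\gamma-\frac12\gamma^{-1}-\frac12},\qquad \frac{p_f}{\sqrt{1-p_f}}\ge\frac{8\big((1-\nu)(\gamma-1)+2\nu\kappa_f\big)}{p_g(1-\gamma^{-1})(1-\nu)},\qquad p_fp_g\ge\tfrac12$$ (the second one being satisfied if $p_f=1$). Let $\Psi_{\min}\le\Psi(x;\bar\rho)$ for all $x\in\Omega$, put $\Phi_0=\nu(\Psi(x_0;\bar\rho)-\Psi_{\min})+(1-\nu)\alpha_0(\phi(x_0)^2+\chi(x_0)^2)$,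 let $\varepsilon>0$ and $T_\varepsilon=\inf\{k\ge0:\phi(x_k)^2+\chi(x_k)^2<\varepsilon\}$. Then, for every process generated by the algorithm under the assumptions above, $$\mathbf E[T_\varepsilon]\le\frac1{2p_fp_g-1}\cdot\frac{4\left(\kappa_g\beta_u+\frac12L_f+2\varepsilon_f+\frac12\bar\rho L_{hc}\right)}{(1-\nu)(1-\gamma^{-1})(1-\theta)\,\xi\,\varepsilon}\,\Phi_0+1 .$$ -/

import Mathlib

open MeasureTheory

noncomputable section

namespace StochSQP

/-- `ℝⁿ` with the Euclidean norm. -/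
abbrev E (n : ℕ) : Type := EuclideanSpace ℝ (Fin n)

/-- The `ℓ∞` norm of a vector of `ℝⁿ`. -/
def supNorm {n : ℕ} (v : E n) : ℝ := ‖WithLp.ofLp v‖

/-- The quadratic form `dᵀ H d`. -/
def quad {n : ℕ} (H : Matrix (Fin n) (Fin n) ℝ) (d : E n) : ℝ :=
  WithLp.ofLp d ⬝ᵥ H.mulVec (WithLp.ofLp d)

/-- The cone `{0} × ℝ₋^{m₂}`, in a product that carries the `ℓ∞` metric. -/
def cone (m₁ m₂ : ℕ) : Set ((Fin m₁ → ℝ) × (Fin m₂ → ℝ)) :=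
  {w | w.1 = 0 ∧ ∀ i, w.2 i ≤ 0}

/-- The problem `min f(x)` subject to `h(x) = 0`, `c(x) ≤ 0` on `ℝⁿ`. -/
structure Problem (n m₁ m₂ : ℕ) where
  f : E n → ℝ
  h : Fin m₁ → E n → ℝ
  c : Fin m₂ → E n → ℝ

namespace Problem

variable {n m₁ m₂ : ℕ} (Q : Problem n m₁ m₂)

/-- Infeasibility: `φ(x) = dist_∞ ((h(x), c(x)) | {0} × ℝ₋)`. -/
def phi (x : E n) : ℝ :=
  Metric.infDist ((fun i => Q.h i x, fun i => Q.c i x) : (Fin m₁ → ℝ) × (Fin m₂ → ℝ))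
    (cone m₁ m₂)

/-- Infeasibility of the constraints linearized at `x`, for the displacement `p`. -/
def linPhi (x p : E n) : ℝ :=
  Metric.infDist
    ((fun i => Q.h i x + inner ℝ (gradient (Q.h i) x) p,
      fun i => Q.c i x + inner ℝ (gradient (Q.c i) x) p) : (Fin m₁ → ℝ) × (Fin m₂ → ℝ))
    (cone m₁ m₂)

/-- `κ(x, σ)`: least linearized infeasibility over `‖p‖_∞ ≤ σ` (used with `σ ≥ 0`). -/
def kap (x : E n) (σ : ℝ) : ℝ := sInf (Q.linPhi x '' {p | supNorm p ≤ σ})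

/-- `Δ_φ(x, σ) = φ(x) - κ(x, σ)`. -/
def deltaPhi (x : E n) (σ : ℝ) : ℝ := Q.phi x - Q.kap x σ

/-- The exact penalty function `Ψ(x; ρ) = f(x) + ρ φ(x)`. -/
def Psi (ρ : ℝ) (x : E n) : ℝ := Q.f x + ρ * Q.phi x

/-- Feasible set of the linear program that defines `χ`. -/
def chiFeasible (βl : ℝ) (x : E n) : Set (E n) :=
  {t | (∀ i, inner ℝ (gradient (Q.h i) x) t = 0) ∧
       (∀ i, inner ℝ (gradient (Q.c i) x) t ≤ 0) ∧ supNorm t ≤ βl / 2}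

/-- Optimality measure: `χ(x) = - min {∇f(x)ᵀ t : t feasible}`. -/
def chi (βl : ℝ) (x : E n) : ℝ :=
  - sInf ((fun t => inner ℝ (gradient Q.f x) t) '' Q.chiFeasible βl x)

/-- The extended Mangasarian–Fromovitz constraint qualification at `x`. -/
def EMFCQ (x : E n) : Prop :=
  LinearIndependent ℝ (fun i => gradient (Q.h i) x) ∧
  ∃ z : E n, (∀ i, inner ℝ (gradient (Q.h i) x) z = 0) ∧
    ∀ i, 0 ≤ Q.c i x → inner ℝ (gradient (Q.c i) x) z < 0

/-- Regularity of the data on the set `Ω`: it is bounded and closed, the functions are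
continuously differentiable, and their gradients are Lipschitz continuous on `Ω`.
(All boundedness requirements on the functions and gradients follow by compactness.) -/
structure RegularOn (Ω : Set (E n)) (Lf : NNReal) (Lh : Fin m₁ → NNReal)
    (Lc : Fin m₂ → NNReal) : Prop where
  bounded : Bornology.IsBounded Ω
  closed : IsClosed Ω
  smooth_f : ContDiff ℝ 1 Q.f
  smooth_h : ∀ i, ContDiff ℝ 1 (Q.h i)
  smooth_c : ∀ i, ContDiff ℝ 1 (Q.c i)
  lip_f : LipschitzOnWith Lf (gradient Q.f) Ω
  lip_h : ∀ i, LipschitzOnWith (Lh i) (gradient (Q.h i)) Ω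
  lip_c : ∀ i, LipschitzOnWith (Lc i) (gradient (Q.c i)) Ω

/-- Feasible set of the direction-finding quadratic program at `x`. -/
def qpFeasible (x : E n) (κ β : ℝ) : Set (E n) :=
  {d | (∀ i, -κ ≤ Q.h i x + inner ℝ (gradient (Q.h i) x) d ∧
             Q.h i x + inner ℝ (gradient (Q.h i) x) d ≤ κ) ∧
       (∀ i, Q.c i x + inner ℝ (gradient (Q.c i) x) d ≤ κ) ∧ supNorm d ≤ β}

end Problem

/-- `L_hc`, the maximum of the Lipschitz constants of all the constraint gradients. -/
def Lhc {m₁ m₂ : ℕ} (Lh : Fin m₁ → NNReal) (Lc : Fin m₂ → NNReal) : ℝ :=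
  ((max (Finset.univ.sup Lh) (Finset.univ.sup Lc) : NNReal) : ℝ)

/-- Parameters of the stochastic SQP algorithm. -/
structure Params where
  σu : ℝ
  κu : ℝ
  βl : ℝ
  βu : ℝ
  γ : ℝ
  θ : ℝ
  αmax : ℝ
  /-- `α₀ = γ^{-j₀} α_max` -/
  j₀ : ℕ
  ζ₀ : ℝ
  ζc : ℝ
  σu_pos : 0 < σu
  κu_pos : 0 < κu
  βl_gt : 2 * σu < βl
  βu_gt : βl < βu
  γ_gt : 1 < γ
  θ_pos : 0 < θ
  θ_lt : θ < 1
  αmax_pos : 0 < αmax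
  j₀_pos : 0 < j₀
  ζ₀_pos : 0 < ζ₀
  ζc_pos : 0 < ζc

/-- The initial step size. -/
def Params.α₀ (A : Params) : ℝ := A.αmax / A.γ ^ A.j₀

/-- The trust radius `σ(x) = min {σ_u, κ_u φ(x)}`. -/
def Params.sigma {n m₁ m₂ : ℕ} (A : Params) (Q : Problem n m₁ m₂) (x : E n) : ℝ :=
  min A.σu (A.κu * Q.phi x)

/-- A random process generated by the stochastic SQP algorithm on the sample space `S`,
from the starting point `x₀`, with initial penalty parameter `ρ₀` and initial gradient
accuracy probability `p₀`.  The gradient estimates `g`, the function estimates `f0`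
(at `x_k`) and `fs` (at the trial point), the Hessian models `H` and the radii `β` are
free; the other quantities are determined by the algorithm.  The multiplier estimates
do not influence the iteration and are not recorded. -/
structure Run {n m₁ m₂ : ℕ} (Q : Problem n m₁ m₂) (A : Params) (x₀ : E n) (ρ₀ p₀ : ℝ)
    (S : Type*) [MeasurableSpace S] where
  x : ℕ → S → E n
  α : ℕ → S → ℝ
  ρ : ℕ → S → ℝ
  g : ℕ → S → E n
  d : ℕ → S → E n
  f0 : ℕ → S → ℝ
  fs : ℕ → S → ℝ
  H : ℕ → S → Matrix (Fin n) (Fin n) ℝ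
  β : ℕ → S → ℝ
  /-- threshold for the size of the gradient estimates -/
  ζ : ℕ → S → ℝ
  /-- required accuracy probability of the gradient estimates -/
  pg : ℕ → S → ℝ
  /-- counter of the threshold updates -/
  j : ℕ → S → ℕ
  /-- the preset sequence of accuracy probabilities -/
  a : ℕ → ℝ
  a_mono : Monotone a
  a_pos : ∀ i, 0 < a i
  a_le : ∀ i, a i ≤ 1
  a_zero : p₀ ≤ a 0
  a_sum : Summable fun i => 1 - a i
  meas_g : ∀ k, Measurable (g k)
  meas_f0 : ∀ k, Measurable (f0 k)
  meas_fs : ∀ k, Measurable (fs k)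
  x_zero : ∀ ω, x 0 ω = x₀
  α_zero : ∀ ω, α 0 ω = A.α₀
  ρ_zero : ∀ ω, ρ 0 ω = ρ₀
  ζ_zero : ∀ ω, ζ 0 ω = A.ζ₀
  pg_zero : ∀ ω, pg 0 ω = p₀
  j_zero : ∀ ω, j 0 ω = 1
  β_mem : ∀ k ω, β k ω ∈ Set.Icc A.βl A.βu
  /-- `d_k` is feasible for the quadratic program with the estimated gradient … -/
  d_mem : ∀ k ω, d k ω ∈
    Q.qpFeasible (x k ω) (Q.kap (x k ω) (A.sigma Q (x k ω))) (β k ω)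
  /-- … and minimizes its objective. -/
  d_min : ∀ k ω, IsMinOn (fun v => inner ℝ (g k ω) v + 1 / 2 * quad (H k ω) v)
    (Q.qpFeasible (x k ω) (Q.kap (x k ω) (A.sigma Q (x k ω))) (β k ω)) (d k ω)
  /-- update of the threshold and of the accuracy probability -/
  ζ_large : ∀ k ω, ζ k ω < ‖g k ω‖ →
    ζ (k + 1) ω = max (ζ k ω + A.ζc) ‖g k ω‖ ∧ pg (k + 1) ω = a (j k ω) ∧
      j (k + 1) ω = j k ω + 1
  ζ_small : ∀ k ω, ‖g k ω‖ ≤ ζ k ω →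
    ζ (k + 1) ω = ζ k ω ∧ pg (k + 1) ω = pg k ω ∧ j (k + 1) ω = j k ω
  /-- update of the penalty parameter -/
  ρ_keep : ∀ k ω,
    1 / 2 * quad (H k ω) (d k ω) ≤
      -inner ℝ (g k ω) (d k ω) + ρ k ω * Q.deltaPhi (x k ω) (A.sigma Q (x k ω)) →
    ρ (k + 1) ω = ρ k ω
  ρ_increase : ∀ k ω,
    ¬ (1 / 2 * quad (H k ω) (d k ω) ≤
      -inner ℝ (g k ω) (d k ω) + ρ k ω * Q.deltaPhi (x k ω) (A.sigma Q (x k ω))) →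
    ρ (k + 1) ω =
      max ((inner ℝ (g k ω) (d k ω) + 1 / 2 * quad (H k ω) (d k ω)) /
            Q.deltaPhi (x k ω) (A.sigma Q (x k ω)))
          (2 * ρ k ω)
  /-- line search: successful step -/
  step_success : ∀ k ω,
    A.θ * α k ω * (-inner ℝ (g k ω) (d k ω)
        + ρ (k + 1) ω * Q.deltaPhi (x k ω) (A.sigma Q (x k ω))) ≤
      (f0 k ω + ρ (k + 1) ω * Q.phi (x k ω))
        - (fs k ω + ρ (k + 1) ω * Q.phi (x k ω + α k ω • d k ω)) →
    x (k + 1) ω = x k ω + α k ω • d k ω ∧ α (k + 1) ω = min (A.γ * α k ω) A.αmax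
  /-- line search: unsuccessful step -/
  step_fail : ∀ k ω,
    ¬ (A.θ * α k ω * (-inner ℝ (g k ω) (d k ω)
        + ρ (k + 1) ω * Q.deltaPhi (x k ω) (A.sigma Q (x k ω))) ≤
      (f0 k ω + ρ (k + 1) ω * Q.phi (x k ω))
        - (fs k ω + ρ (k + 1) ω * Q.phi (x k ω + α k ω • d k ω))) →
    x (k + 1) ω = x k ω ∧ α (k + 1) ω = A.γ⁻¹ * α k ω

namespace Run

variable {n m₁ m₂ : ℕ} {Q : Problem n m₁ m₂} {A : Params} {x₀ : E n} {ρ₀ p₀ : ℝ}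
  {S : Type*} [MeasurableSpace S] (R : Run Q A x₀ ρ₀ p₀ S)

/-- `𝓕_{k-1}`: generated by the estimates `g_i, f0_i, fs_i` with `i < k`. -/
def past (k : ℕ) : MeasurableSpace S :=
  ⨆ i : Fin k, MeasurableSpace.comap (R.g i) inferInstance ⊔
    MeasurableSpace.comap (R.f0 i) inferInstance ⊔ MeasurableSpace.comap (R.fs i) inferInstance

/-- `𝓕_{k-1/2}`: generated by `𝓕_{k-1}` and `g_k`. -/
def pastHalf (k : ℕ) : MeasurableSpace S :=
  R.past k ⊔ MeasurableSpace.comap (R.g k) inferInstance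

/-- The search direction is a random vector computed from the history and `g_k`. -/
def Adapted : Prop := ∀ k, Measurable[R.pastHalf k] (R.d k)

/-- The iterates lie in `K`, and the trial points `x_k + t d_k`, `0 ≤ t ≤ α_k`, in `Ω`. -/
def StaysIn (K Ω : Set (E n)) : Prop :=
  (∀ k ω, R.x k ω ∈ K) ∧
  ∀ k ω, ∀ t ∈ Set.Icc (0 : ℝ) (R.α k ω), R.x k ω + t • R.d k ω ∈ Ω

/-- `2 ξ ‖v‖² ≤ vᵀ H_k v ≤ M_H ‖v‖²` for all `v` and `k`. -/
def HessianBounds (ξ MH : ℝ) : Prop :=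
  ∀ k ω v, 2 * ξ * ‖v‖ ^ 2 ≤ quad (R.H k ω) v ∧ quad (R.H k ω) v ≤ MH * ‖v‖ ^ 2

/-- The event `I_k` that the gradient estimate is `κ_g`-sufficiently accurate. -/
def gradEvent (κg : ℝ) (k : ℕ) : Set S :=
  {ω | ‖R.g k ω - gradient Q.f (R.x k ω)‖ ≤ κg * R.α k ω * ‖R.d k ω‖}

/-- The event `J_k` that the function estimates are `ε_f`-sufficiently accurate. -/
def funEvent (εf : ℝ) (k : ℕ) : Set S :=
  {ω | |R.f0 k ω - Q.f (R.x k ω)| ≤ εf * R.α k ω ^ 2 * ‖R.d k ω‖ ^ 2 ∧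
       |R.fs k ω - Q.f (R.x k ω + R.α k ω • R.d k ω)|
          ≤ εf * R.α k ω ^ 2 * ‖R.d k ω‖ ^ 2}

/-- `Pr(I_k | 𝓕_{k-1}) ≥ p_k^g`. -/
def GradAccurate (μ : Measure S) (κg : ℝ) : Prop :=
  ∀ k, ∀ᵐ ω ∂μ,
    R.pg k ω ≤ (μ[(R.gradEvent κg k).indicator (fun _ => (1 : ℝ)) | R.past k]) ω

/-- `Pr(J_k | 𝓕_{k-1/2}) ≥ p_f`. -/
def FunAccurate (μ : Measure S) (εf pf : ℝ) : Prop :=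
  ∀ k, ∀ᵐ ω ∂μ,
    pf ≤ (μ[(R.funEvent εf k).indicator (fun _ => (1 : ℝ)) | R.pastHalf k]) ω

/-- The `κ_f`-variance condition on the function estimates. -/
def VarianceCond (μ : Measure S) (κf : ℝ) : Prop :=
  ∀ k,
    (MemLp (fun ω => R.fs k ω - Q.f (R.x k ω + R.α k ω • R.d k ω)) 2 μ ∧
      ∀ᵐ ω ∂μ,
        (μ[fun ω => |R.fs k ω - Q.f (R.x k ω + R.α k ω • R.d k ω)| ^ 2 | R.pastHalf k]) ω
          ≤ κf ^ 2 * R.α k ω ^ 2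
              * (Q.phi (R.x k ω) ^ 2 + Q.chi A.βl (R.x k ω) ^ 2) ^ 2) ∧
    (MemLp (fun ω => R.f0 k ω - Q.f (R.x k ω)) 2 μ ∧
      ∀ᵐ ω ∂μ,
        (μ[fun ω => |R.f0 k ω - Q.f (R.x k ω)| ^ 2 | R.pastHalf k]) ω
          ≤ κf ^ 2 * R.α k ω ^ 2
              * (Q.phi (R.x k ω) ^ 2 + Q.chi A.βl (R.x k ω) ^ 2) ^ 2)

/-- `T_ε = inf {k : φ(x_k)² + χ(x_k)² < ε}`, equal to `∞` if there is no such `k`. -/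
def hitTime (ε : ℝ) (ω : S) : ENNReal :=
  ⨅ (k : ℕ) (_ : Q.phi (R.x k ω) ^ 2 + Q.chi A.βl (R.x k ω) ^ 2 < ε), (k : ENNReal)

end Run

/-- The initial value `Φ₀` of the random merit function
`Φ_k = ν (Ψ(x_k; ρ̄) - Ψ_min) + (1 - ν) α_k (φ(x_k)² + χ(x_k)²)`. -/
def merit₀ {n m₁ m₂ : ℕ} (Q : Problem n m₁ m₂) (A : Params) (x₀ : E n)
    (ρbar ν Ψmin : ℝ) : ℝ :=
  ν * (Q.Psi ρbar x₀ - Ψmin) + (1 - ν) * A.α₀ * (Q.phi x₀ ^ 2 + Q.chi A.βl x₀ ^ 2)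

end StochSQP

end

/-!
The merit value `u = Ψ(x_k; ρ̄) - Ψ_min` and the stationarity `e = φ(x_k)² + χ(x_k)²` are followed
along the level `i` of the step size `α_k = α_max γ⁻ⁱ`. With probability at least `3/4` both
estimates of an iteration are accurate. Then extended MFCQ and compactness of `K` give
`e ≤ C ‖d_k‖²`, so a successful step lowers `u` by `c α_k e`, and Taylor expansion makes the step
successful as soon as `i ≥ m`. A step accepted on inaccurate estimates raises `u` by an error of
conditional mean at most a small multiple of `α_k e`, by the conditional Cauchy–Schwarz inequality.

Since `χ` need not be continuous, `e` is out of control after a successful step, and a merit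
function in which `e` enters with a positive weight need not decrease. The Lyapunov function
`V = u + ε v (i - m)₊ - w_i e`, with `w_i = 4ⁱ v` for `i ≤ m` and `w_i = 0` beyond, has the
opposite sign: after a successful step the unknown term may be dropped, and after a failure at a
level below `m` the weight quadruples while `u` and `e` stay put. As long as `e ≥ ε`, the mean of
`V` drops by at least `v ε / 2` per iteration. Moreover `V ≥ 0` almost surely: from a level at most
`m`, a run of accurate iterations, which has positive probability, ends with a step that lowers the
nonnegative `u` by at least `c α_max γ⁻ᵐ e`, so `u` must have been at least that large.

Hence `E[T_ε] ≤ 2 u₀ / (v ε)` with `v` independent of `ν`, and the factor `1 / (1 - ν)` of the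
claimed bound absorbs `v` once `ν` is close to `1`.
-/

namespace StochSQP

open Filter Topology

/-! ### Linearized constraints and stationarity -/

section Prerequisites

theorem continuous_gradient {𝕜 F : Type*} [RCLike 𝕜] [NormedAddCommGroup F]
    [InnerProductSpace 𝕜 F] [CompleteSpace F] {f : F → 𝕜} (hf : ContDiff 𝕜 1 f) :
    Continuous (gradient f) :=
  (InnerProductSpace.toDual 𝕜 F).symm.continuous.comp (hf.continuous_fderiv one_ne_zero)

theorem continuous_inner_gradient {F : Type*} [NormedAddCommGroup F] [InnerProductSpace ℝ F]
    [CompleteSpace F] {f : F → ℝ} (hf : ContDiff ℝ 1 f) :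
    Continuous fun y : F × F => inner ℝ (gradient f y.1) y.2 :=
  ((continuous_gradient hf).comp continuous_fst).inner continuous_snd

theorem eventually_forall_norm_gradient_sub_le {ι F : Type*} [Finite ι] [NormedAddCommGroup F]
    [InnerProductSpace ℝ F] [CompleteSpace F] {f : ι → F → ℝ} (hf : ∀ i, ContDiff ℝ 1 (f i))
    (y : F) {δ : ℝ} (hδ : 0 < δ) :
    ∀ᶠ x in 𝓝 y, ∀ i, ‖gradient (f i) x - gradient (f i) y‖ ≤ δ := by
  refine eventually_all.2 fun i => ?_
  have hc := (continuous_gradient (hf i)).tendsto y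
  filter_upwards [hc.eventually (Metric.closedBall_mem_nhds _ hδ)] with x hx
  rwa [← dist_eq_norm]

theorem isClosed_setOf_forall {X ι : Type*} [TopologicalSpace X] {p : ι → X → Prop}
    (h : ∀ i, IsClosed {x | p i x}) : IsClosed {x | ∀ i, p i x} := by
  simp only [Set.ofPred_forall]
  exact isClosed_iInter h

theorem lowerSemicontinuous_of_isLeast_image {X Y : Type*} [TopologicalSpace X]
    [TopologicalSpace Y] {C : Set Y} (hC : IsCompact C) {G : Set (X × Y)} (hG : IsClosed G)
    (hGC : ∀ y ∈ G, y.2 ∈ C) {f : X × Y → ℝ} (hf : Continuous f) {v : X → ℝ}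
    (hv : ∀ x, IsLeast ((fun y => f (x, y)) '' {y | (x, y) ∈ G}) (v x)) :
    LowerSemicontinuous v := by
  refine lowerSemicontinuous_iff_isClosed_preimage.2 fun a => ?_
  have : CompactSpace C := isCompact_iff_compactSpace.1 hC
  have hclosed := isClosedMap_fst_of_compactSpace (X := X) (Y := C) _
    ((hG.inter (isClosed_le hf continuous_const)).preimage
      (f := fun q : X × C => (q.1, (q.2 : Y))) (by fun_prop) : IsClosed
        {q : X × C | (q.1, (q.2 : Y)) ∈ G ∧ f (q.1, q.2) ≤ a})
  convert hclosed using 1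
  ext x
  constructor
  · intro hx
    obtain ⟨y, hy, hyv⟩ := (hv x).1
    exact ⟨(x, ⟨y, hGC _ hy⟩), ⟨hy, hyv.trans_le hx⟩, rfl⟩
  · rintro ⟨⟨x, y⟩, ⟨hy, hya⟩, rfl⟩
    exact ((hv x).2 ⟨y, hy, rfl⟩).trans hya

theorem exists_inner_eq_ite {ι F : Type*} [DecidableEq ι] [NormedAddCommGroup F]
    [InnerProductSpace ℝ F] [FiniteDimensional ℝ F] {v : ι → F} (hv : LinearIndependent ℝ v)
    (j : ι) : ∃ w : F, ∀ i, inner ℝ (v i) w = if i = j then 1 else 0 := by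
  have := FiniteDimensional.complete ℝ F
  obtain ⟨l, hl⟩ := ((Finsupp.lapply j).comp hv.repr).exists_extend
  refine ⟨(InnerProductSpace.toDual ℝ F).symm (LinearMap.toContinuousLinearMap l), fun i => ?_⟩
  have hi : v i ∈ Submodule.span ℝ (Set.range v) := Submodule.subset_span ⟨i, rfl⟩
  have hli := LinearMap.congr_fun hl ⟨v i, hi⟩
  simp only [LinearMap.comp_apply, Submodule.subtype_apply] at hli
  rw [real_inner_comm, InnerProductSpace.toDual_symm_apply, LinearMap.coe_toContinuousLinearMap',
    hli, hv.repr_eq_single i _ rfl]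
  simp [Finsupp.single_apply]

theorem exists_norm_le_inner_eq {ι F : Type*} [Finite ι] [NormedAddCommGroup F]
    [InnerProductSpace ℝ F] [FiniteDimensional ℝ F] {v : ι → F} (hv : LinearIndependent ℝ v) :
    ∃ W : ℝ, 0 ≤ W ∧ ∀ (r : ℝ) (b : ι → ℝ), (∀ i, |b i| ≤ r) →
      ∃ s : F, ‖s‖ ≤ W * r ∧ ∀ i, inner ℝ (v i) s = b i := by
  classical
  cases nonempty_fintype ι
  choose w hw using exists_inner_eq_ite hv
  refine ⟨∑ j, ‖w j‖, Finset.sum_nonneg fun _ _ => norm_nonneg _,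
    fun r b hb => ⟨∑ j, b j • w j, ?_, fun i => ?_⟩⟩
  · rw [Finset.sum_mul]
    refine norm_sum_le_of_le _ fun j _ => ?_
    rw [norm_smul, mul_comm]
    exact mul_le_mul_of_nonneg_left (hb j) (norm_nonneg _)
  · simp [inner_sum, inner_smul_right, hw]

theorem exists_pos_forall_le_mul {κ : Type*} [Finite κ] (a b : κ → ℝ) (hb : ∀ i, 0 < b i) :
    ∃ D : ℝ, 0 < D ∧ ∀ i, a i ≤ D * b i := by
  obtain ⟨D, hD⟩ := (Set.finite_range fun i => a i / b i).bddAbove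
  refine ⟨max D 1, lt_max_of_lt_right one_pos, fun i => ?_⟩
  rw [← div_le_iff₀ (hb i)]
  exact (hD ⟨i, rfl⟩).trans (le_max_left _ _)

/- A quantitative Mangasarian–Fromovitz condition: correct the equations by a combination of the
dual system of `v`, then move far enough along `z` to make all the inequalities hold. -/
theorem exists_norm_le_inner_eq_and_inner_le {ι κ F : Type*} [Finite ι] [Finite κ]
    [NormedAddCommGroup F] [InnerProductSpace ℝ F] [FiniteDimensional ℝ F] {v : ι → F}
    (hv : LinearIndependent ℝ v) {u : κ → F} {z : F} (hvz : ∀ i, inner ℝ (v i) z = 0)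
    (huz : ∀ k, inner ℝ (u k) z < 0) :
    ∃ D : ℝ, 0 < D ∧ ∀ r : ℝ, 0 ≤ r → ∀ b : ι → ℝ, (∀ i, |b i| ≤ r) →
      ∃ p : F, ‖p‖ ≤ D * r ∧ (∀ i, inner ℝ (v i) p = b i) ∧ ∀ k, inner ℝ (u k) p ≤ -r := by
  obtain ⟨W, hW, hs⟩ := exists_norm_le_inner_eq hv
  obtain ⟨D, hD, hDu⟩ := exists_pos_forall_le_mul (fun k => ‖u k‖ * W + 1)
    (fun k => -inner ℝ (u k) z) fun k => neg_pos.2 (huz k)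
  refine ⟨W + D * ‖z‖ + 1, by positivity, fun r hr b hb => ?_⟩
  obtain ⟨s, hsr, hsb⟩ := hs r b hb
  refine ⟨s + (r * D) • z, ?_, fun i => ?_, fun k => ?_⟩
  · have hz : ‖(r * D) • z‖ = r * D * ‖z‖ := by
      rw [norm_smul, Real.norm_of_nonneg (by positivity)]
    linarith [norm_add_le s ((r * D) • z)]
  · rw [inner_add_right, inner_smul_right, hvz, mul_zero, add_zero, hsb]
  · have hus : inner ℝ (u k) s ≤ ‖u k‖ * (W * r) :=
      (real_inner_le_norm _ _).trans (mul_le_mul_of_nonneg_left hsr (norm_nonneg _))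
    have hur := mul_le_mul_of_nonneg_left (hDu k) hr
    rw [inner_add_right, inner_smul_right]
    linarith

end Prerequisites

section SupNorm

variable {n : ℕ}

theorem continuous_supNorm : Continuous (supNorm : E n → ℝ) :=
  continuous_norm.comp (PiLp.continuous_ofLp 2 _)

theorem supNorm_nonneg (v : E n) : 0 ≤ supNorm v := norm_nonneg _

theorem supNorm_zero : supNorm (0 : E n) = 0 := by simp [supNorm]

theorem supNorm_smul (t : ℝ) (v : E n) : supNorm (t • v) = |t| * supNorm v := by
  simp [supNorm, norm_smul]

theorem supNorm_add_le (v w : E n) : supNorm (v + w) ≤ supNorm v + supNorm w := by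
  simpa [supNorm] using norm_add_le (WithLp.ofLp v) (WithLp.ofLp w)

theorem supNorm_le_norm (v : E n) : supNorm v ≤ ‖v‖ :=
  (pi_norm_le_iff_of_nonneg (norm_nonneg _)).2 fun i => PiLp.norm_apply_le v i

theorem norm_le_sqrt_mul_supNorm (v : E n) : ‖v‖ ≤ Real.sqrt n * supNorm v := by
  rw [EuclideanSpace.norm_eq]
  have hsum : ∑ i, ‖v i‖ ^ 2 ≤ n * supNorm v ^ 2 := by
    calc ∑ i, ‖v i‖ ^ 2 ≤ ∑ _i : Fin n, supNorm v ^ 2 := by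
          gcongr with i
          exact norm_le_pi_norm (WithLp.ofLp v) i
      _ = n * supNorm v ^ 2 := by simp
  refine (Real.sqrt_le_sqrt hsum).trans_eq ?_
  rw [Real.sqrt_mul (by positivity), Real.sqrt_sq (supNorm_nonneg v)]

theorem isCompact_supNorm_le (σ : ℝ) : IsCompact {p : E n | supNorm p ≤ σ} := by
  refine Metric.isCompact_of_isClosed_isBounded
    (isClosed_le continuous_supNorm continuous_const) ?_
  refine (Metric.isBounded_closedBall (x := 0) (r := Real.sqrt n * σ)).subset fun p hp => ?_
  rw [mem_closedBall_zero_iff]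
  exact (norm_le_sqrt_mul_supNorm p).trans (mul_le_mul_of_nonneg_left hp (Real.sqrt_nonneg _))

end SupNorm

theorem infDist_cone_le_iff {m₁ m₂ : ℕ} (w : (Fin m₁ → ℝ) × (Fin m₂ → ℝ)) {r : ℝ} (hr : 0 ≤ r) :
    Metric.infDist w (cone m₁ m₂) ≤ r ↔ (∀ i, |w.1 i| ≤ r) ∧ ∀ i, w.2 i ≤ r := by
  have hne : (cone m₁ m₂).Nonempty := ⟨0, by simp [cone]⟩
  constructor
  · intro h
    have hlt : ∀ s, r < s → (∀ i, |w.1 i| ≤ s) ∧ ∀ i, w.2 i ≤ s := by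
      intro s hs
      obtain ⟨y, hy, hd⟩ := (Metric.infDist_lt_iff hne).1 (h.trans_lt hs)
      rw [Prod.dist_eq, max_lt_iff] at hd
      constructor
      · intro i
        have := (dist_le_pi_dist w.1 y.1 i).trans hd.1.le
        rw [hy.1] at this
        simpa [Real.dist_eq] using this
      · intro i
        have := (dist_le_pi_dist w.2 y.2 i).trans hd.2.le
        rw [Real.dist_eq] at this
        linarith [le_abs_self (w.2 i - y.2 i), hy.2 i]
    exact ⟨fun i => le_of_forall_gt_imp_ge_of_dense fun s hs => (hlt s hs).1 i,
      fun i => le_of_forall_gt_imp_ge_of_dense fun s hs => (hlt s hs).2 i⟩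
  · rintro ⟨h₁, h₂⟩
    have hproj : ((0, fun i => min (w.2 i) 0) : (Fin m₁ → ℝ) × (Fin m₂ → ℝ)) ∈ cone m₁ m₂ :=
      ⟨rfl, fun i => min_le_right _ _⟩
    refine (Metric.infDist_le_dist_of_mem hproj).trans ?_
    rw [Prod.dist_eq]
    refine max_le ((dist_pi_le_iff hr).2 fun i => ?_) ((dist_pi_le_iff hr).2 fun i => ?_)
    · simpa [Real.dist_eq] using h₁ i
    · rw [Real.dist_eq]
      rcases le_total (w.2 i) 0 with h | h
      · simpa [min_eq_left h] using hr
      · simpa [min_eq_right h, abs_of_nonneg h] using h₂ i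

namespace Problem

variable {n m₁ m₂ : ℕ} {Q : Problem n m₁ m₂}

theorem phi_nonneg (x : E n) : 0 ≤ Q.phi x := Metric.infDist_nonneg

theorem linPhi_nonneg (x p : E n) : 0 ≤ Q.linPhi x p := Metric.infDist_nonneg

theorem phi_le_iff (x : E n) {r : ℝ} (hr : 0 ≤ r) :
    Q.phi x ≤ r ↔ (∀ i, |Q.h i x| ≤ r) ∧ ∀ i, Q.c i x ≤ r :=
  infDist_cone_le_iff _ hr

theorem abs_h_le_phi (x : E n) (i : Fin m₁) : |Q.h i x| ≤ Q.phi x :=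
  ((phi_le_iff x (phi_nonneg x)).1 le_rfl).1 i

theorem c_le_phi (x : E n) (i : Fin m₂) : Q.c i x ≤ Q.phi x :=
  ((phi_le_iff x (phi_nonneg x)).1 le_rfl).2 i

theorem linPhi_le_iff (x p : E n) {r : ℝ} (hr : 0 ≤ r) :
    Q.linPhi x p ≤ r ↔ (∀ i, |Q.h i x + inner ℝ (gradient (Q.h i) x) p| ≤ r) ∧
      ∀ i, Q.c i x + inner ℝ (gradient (Q.c i) x) p ≤ r :=
  infDist_cone_le_iff _ hr

theorem linPhi_smul_le (x p : E n) {t : ℝ} (ht₀ : 0 ≤ t) (ht₁ : t ≤ 1) :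
    Q.linPhi x (t • p) ≤ (1 - t) * Q.phi x + t * Q.linPhi x p := by
  have hφ := phi_nonneg (Q := Q) x
  have hl := linPhi_nonneg (Q := Q) x p
  have ht₁' : 0 ≤ 1 - t := by linarith
  obtain ⟨hh, hc⟩ := (linPhi_le_iff (Q := Q) x p hl).1 le_rfl
  rw [linPhi_le_iff x _ (by positivity)]
  constructor <;> intro i <;> rw [inner_smul_right]
  · have hconv : Q.h i x + t * inner ℝ (gradient (Q.h i) x) p
      = (1 - t) * Q.h i x + t * (Q.h i x + inner ℝ (gradient (Q.h i) x) p) := by ring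
    rw [hconv]
    refine (abs_add_le _ _).trans ?_
    rw [abs_mul, abs_mul, abs_of_nonneg ht₀, abs_of_nonneg ht₁']
    gcongr
    · exact abs_h_le_phi x i
    · exact hh i
  · linarith [mul_le_mul_of_nonneg_left (c_le_phi (Q := Q) x i) ht₁',
      mul_le_mul_of_nonneg_left (hc i) ht₀]

theorem continuous_linPhi_right (x : E n) : Continuous (Q.linPhi x) := by
  refine (Metric.continuous_infDist_pt _).comp (Continuous.prodMk ?_ ?_) <;>
  · refine continuous_pi fun i => ?_
    fun_prop

theorem isLeast_kap (x : E n) {σ : ℝ} (hσ : 0 ≤ σ) :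
    IsLeast (Q.linPhi x '' {p | supNorm p ≤ σ}) (Q.kap x σ) :=
  ((isCompact_supNorm_le σ).image (continuous_linPhi_right x)).isLeast_sInf
    ⟨_, 0, by simpa [supNorm_zero] using hσ, rfl⟩

theorem kap_le (x : E n) {σ : ℝ} {p : E n} (hp : supNorm p ≤ σ) : Q.kap x σ ≤ Q.linPhi x p :=
  (isLeast_kap x ((supNorm_nonneg p).trans hp)).2 ⟨p, hp, rfl⟩

theorem kap_nonneg (x : E n) (σ : ℝ) : 0 ≤ Q.kap x σ :=
  Real.sInf_nonneg (by rintro _ ⟨q, -, rfl⟩; exact linPhi_nonneg x q)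

theorem sigma_nonneg (A : Params) (x : E n) : 0 ≤ A.sigma Q x :=
  le_min A.σu_pos.le (mul_nonneg A.κu_pos.le (phi_nonneg x))

theorem mem_qpFeasible_iff (x d : E n) {κ β : ℝ} (hκ : 0 ≤ κ) :
    d ∈ Q.qpFeasible x κ β ↔ Q.linPhi x d ≤ κ ∧ supNorm d ≤ β := by
  rw [linPhi_le_iff x d hκ]
  simp only [qpFeasible, Set.mem_ofPred_eq, abs_le, and_assoc]

theorem isClosed_chiFeasible (βl : ℝ) (x : E n) : IsClosed (Q.chiFeasible βl x) := by
  refine (isClosed_setOf_forall fun i => ?_).inter ((isClosed_setOf_forall fun i => ?_).inter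
    (isClosed_le continuous_supNorm continuous_const))
  · exact isClosed_eq (by fun_prop) continuous_const
  · exact isClosed_le (by fun_prop) continuous_const

theorem isLeast_neg_chi {βl : ℝ} (hβ : 0 ≤ βl) (x : E n) :
    IsLeast ((fun t => inner ℝ (gradient Q.f x) t) '' Q.chiFeasible βl x) (-Q.chi βl x) := by
  have hcompact : IsCompact (Q.chiFeasible βl x) :=
    (isCompact_supNorm_le (βl / 2)).of_isClosed_subset (isClosed_chiFeasible βl x)
      fun t ht => ht.2.2
  rw [chi, neg_neg]
  refine (hcompact.image (by fun_prop)).isLeast_sInf (Set.Nonempty.image _ ⟨0, ?_⟩)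
  exact ⟨by simp, by simp, by rw [supNorm_zero]; positivity⟩

theorem exists_chi_eq {βl : ℝ} (hβ : 0 ≤ βl) (x : E n) :
    ∃ t ∈ Q.chiFeasible βl x, Q.chi βl x = -inner ℝ (gradient Q.f x) t := by
  obtain ⟨t, ht, hχ⟩ := (isLeast_neg_chi (Q := Q) hβ x).1
  exact ⟨t, ht, neg_eq_iff_eq_neg.1 hχ.symm⟩

theorem chi_nonneg {βl : ℝ} (hβ : 0 ≤ βl) (x : E n) : 0 ≤ Q.chi βl x := by
  refine neg_nonpos.1 ((isLeast_neg_chi hβ x).2 ⟨0, ?_, inner_zero_right _⟩)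
  exact ⟨by simp, by simp, by rw [supNorm_zero]; positivity⟩

/-- The functions of the problem are continuously differentiable: the part of `RegularOn` that does
not refer to a domain. -/
structure IsC1 (Q : Problem n m₁ m₂) : Prop where
  f : ContDiff ℝ 1 Q.f
  h : ∀ i, ContDiff ℝ 1 (Q.h i)
  c : ∀ i, ContDiff ℝ 1 (Q.c i)

theorem RegularOn.isC1 {Ω : Set (E n)} {Lf : NNReal} {Lh : Fin m₁ → NNReal}
    {Lc : Fin m₂ → NNReal} (hΩ : Q.RegularOn Ω Lf Lh Lc) : Q.IsC1 :=
  ⟨hΩ.smooth_f, hΩ.smooth_h, hΩ.smooth_c⟩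

namespace IsC1

theorem continuous_phi (hQ : Q.IsC1) : Continuous Q.phi :=
  (Metric.continuous_infDist_pt _).comp (Continuous.prodMk
    (continuous_pi fun i => (hQ.h i).continuous) (continuous_pi fun i => (hQ.c i).continuous))

theorem continuous_Psi (hQ : Q.IsC1) (ρ : ℝ) : Continuous (Q.Psi ρ) :=
  hQ.f.continuous.add (continuous_const.mul hQ.continuous_phi)

theorem continuous_linPhi (hQ : Q.IsC1) : Continuous fun y : E n × E n => Q.linPhi y.1 y.2 :=
  (Metric.continuous_infDist_pt _).comp (Continuous.prodMk
    (continuous_pi fun i => ((hQ.h i).continuous.comp continuous_fst).add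
      (continuous_inner_gradient (hQ.h i)))
    (continuous_pi fun i => ((hQ.c i).continuous.comp continuous_fst).add
      (continuous_inner_gradient (hQ.c i))))

theorem measurable_kap (hQ : Q.IsC1) (A : Params) : Measurable fun x => Q.kap x (A.sigma Q x) := by
  have hsigma : Continuous (A.sigma Q) :=
    continuous_const.min (continuous_const.mul hQ.continuous_phi)
  refine (lowerSemicontinuous_of_isLeast_image (isCompact_supNorm_le A.σu)
    (G := {y | supNorm y.2 ≤ A.sigma Q y.1})
    (isClosed_le (continuous_supNorm.comp continuous_snd) (hsigma.comp continuous_fst))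
    (fun y (hy : supNorm y.2 ≤ _) => hy.trans (min_le_left _ _)) hQ.continuous_linPhi
    fun x => ?_).measurable
  exact isLeast_kap x (sigma_nonneg A x)

theorem measurable_chi (hQ : Q.IsC1) {βl : ℝ} (hβ : 0 ≤ βl) : Measurable (Q.chi βl) := by
  refine measurable_neg_iff.1 (lowerSemicontinuous_of_isLeast_image (isCompact_supNorm_le (βl / 2))
    (G := {y | y.2 ∈ Q.chiFeasible βl y.1}) ?_ (fun y hy => hy.2.2)
    (continuous_inner_gradient hQ.f) (isLeast_neg_chi hβ)).measurable
  refine (isClosed_setOf_forall fun i => ?_).inter ((isClosed_setOf_forall fun i => ?_).inter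
    (isClosed_le (continuous_supNorm.comp continuous_snd) continuous_const))
  · exact isClosed_eq (continuous_inner_gradient (hQ.h i)) continuous_const
  · exact isClosed_le (continuous_inner_gradient (hQ.c i)) continuous_const

/- Near `y` the constraints that are inactive at `y` absorb any bounded step, once it is scaled by
a small fixed factor `t`. -/
theorem eventually_forall_inactive_le (hQ : Q.IsC1) (y : E n) (B : ℝ) :
    ∃ t : ℝ, 0 < t ∧ t ≤ 1 ∧ ∀ᶠ x in 𝓝 y, ∀ i, Q.c i y < 0 → ∀ p : E n, ‖p‖ ≤ B →
      Q.c i x + t * inner ℝ (gradient (Q.c i) x) p ≤ 0 := by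
  have hlim : ∀ i, Q.c i y < 0 →
      ∀ᶠ q : ℝ × E n in 𝓝 (0, y), Q.c i q.2 + |q.1| * (‖gradient (Q.c i) q.2‖ * B) < 0 := by
    intro i hi
    have hcont : Continuous fun q : ℝ × E n =>
        Q.c i q.2 + |q.1| * (‖gradient (Q.c i) q.2‖ * B) :=
      ((hQ.c i).continuous.comp continuous_snd).add ((continuous_abs.comp continuous_fst).mul
        (((continuous_gradient (hQ.c i)).comp continuous_snd).norm.mul continuous_const))
    exact hcont.continuousAt.eventually_lt_const (by simpa using hi)
  have hall : ∀ᶠ q : ℝ × E n in 𝓝 0 ×ˢ 𝓝 y, ∀ i, Q.c i y < 0 →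
      Q.c i q.2 + |q.1| * (‖gradient (Q.c i) q.2‖ * B) < 0 := by
    rw [← nhds_prod_eq]
    exact eventually_all.2 fun i => eventually_imp_distrib_left.2 (hlim i)
  obtain ⟨t, ⟨htc, ht₁⟩, ht₀⟩ := (((hall.curry.and (Iic_mem_nhds one_pos)).filter_mono
    nhdsWithin_le_nhds).and (self_mem_nhdsWithin (s := Set.Ioi (0 : ℝ)))).exists
  refine ⟨t, ht₀, ht₁, htc.mono fun x hx i hi p hp => ?_⟩
  have hxi := hx i hi
  rw [abs_of_pos ht₀] at hxi
  have hinner : inner ℝ (gradient (Q.c i) x) p ≤ ‖gradient (Q.c i) x‖ * B :=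
    (real_inner_le_norm _ _).trans (mul_le_mul_of_nonneg_left hp (norm_nonneg _))
  linarith [mul_le_mul_of_nonneg_left hinner (le_of_lt ht₀)]

theorem eventually_phi_le (hQ : Q.IsC1) (y : E n) : ∀ᶠ x in 𝓝 y, Q.phi x ≤ Q.phi y + 1 :=
  (hQ.continuous_phi.tendsto y).eventually (Iic_mem_nhds (by linarith))

theorem eventually_exists_norm_le_mul_phi (hQ : Q.IsC1) {y : E n} (hy : Q.EMFCQ y) :
    ∃ D : ℝ, 0 < D ∧ ∀ᶠ x in 𝓝 y, ∃ p : E n, ‖p‖ ≤ D * Q.phi x ∧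
      (∀ i, |Q.h i x + inner ℝ (gradient (Q.h i) x) p| ≤ Q.phi x / 2) ∧
      ∀ i, 0 ≤ Q.c i y → inner ℝ (gradient (Q.c i) x) p ≤ -(Q.phi x / 2) := by
  obtain ⟨hli, z, hhz, hcz⟩ := hy
  obtain ⟨D, hD, hstep⟩ := exists_norm_le_inner_eq_and_inner_le hli hhz
    (u := fun i : {i // 0 ≤ Q.c i y} => gradient (Q.c i) y) fun i => hcz i i.2
  have hδ : 0 < 1 / (2 * D) := by positivity
  refine ⟨D, hD, ?_⟩
  filter_upwards [eventually_forall_norm_gradient_sub_le hQ.h y hδ,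
    eventually_forall_norm_gradient_sub_le hQ.c y hδ] with x hhx hcx
  obtain ⟨p, hp, hhp, hcp⟩ := hstep (Q.phi x) (phi_nonneg x) (fun i => -Q.h i x)
    fun i => (abs_neg _).trans_le (abs_h_le_phi x i)
  have hpert : ∀ v w : E n, ‖v - w‖ ≤ 1 / (2 * D) → |inner ℝ (v - w) p| ≤ Q.phi x / 2 := by
    intro v w hvw
    calc |inner ℝ (v - w) p| ≤ ‖v - w‖ * ‖p‖ := abs_real_inner_le_norm _ _
      _ ≤ 1 / (2 * D) * (D * Q.phi x) := by gcongr
      _ = Q.phi x / 2 := by field_simp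
  refine ⟨p, hp, fun i => ?_, fun i hi => ?_⟩
  · convert hpert _ _ (hhx i) using 2
    rw [inner_sub_left, hhp]
    ring
  · have hsub := (le_abs_self _).trans (hpert _ _ (hcx i))
    rw [inner_sub_left] at hsub
    linarith [hcp ⟨i, hi⟩]

theorem eventually_linPhi_le (hQ : Q.IsC1) {y : E n} (hy : Q.EMFCQ y) :
    ∃ D c : ℝ, 0 < D ∧ 0 < c ∧ c ≤ 1 ∧ ∀ᶠ x in 𝓝 y, ∃ p : E n,
      ‖p‖ ≤ D * Q.phi x ∧ Q.linPhi x p ≤ (1 - c) * Q.phi x := by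
  obtain ⟨D, hD, hstep⟩ := hQ.eventually_exists_norm_le_mul_phi hy
  obtain ⟨t, ht₀, ht₁, hinactive⟩ := hQ.eventually_forall_inactive_le y (D * (Q.phi y + 1))
  refine ⟨D, t / 2, hD, by linarith, by linarith, ?_⟩
  filter_upwards [hstep, hinactive, hQ.eventually_phi_le y] with x ⟨p, hp, hhp, hcp⟩ hx hφy
  have hφ := phi_nonneg (Q := Q) x
  have ht₁' : 0 ≤ 1 - t := by linarith
  refine ⟨t • p, ?_, (linPhi_le_iff x _ (mul_nonneg (by linarith) hφ)).2
    ⟨fun i => ?_, fun i => ?_⟩⟩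
  · rw [norm_smul, Real.norm_of_nonneg ht₀.le]
    exact (mul_le_of_le_one_left (norm_nonneg _) ht₁).trans hp
  · have hconv : Q.h i x + inner ℝ (gradient (Q.h i) x) (t • p)
        = (1 - t) * Q.h i x + t * (Q.h i x + inner ℝ (gradient (Q.h i) x) p) := by
      rw [inner_smul_right]; ring
    rw [hconv]
    refine (abs_add_le _ _).trans ?_
    rw [abs_mul, abs_mul, abs_of_nonneg ht₀.le, abs_of_nonneg ht₁']
    linarith [mul_le_mul_of_nonneg_left (abs_h_le_phi (Q := Q) x i) ht₁',
      mul_le_mul_of_nonneg_left (hhp i) ht₀.le]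
  · rw [inner_smul_right]
    rcases lt_or_ge (Q.c i y) 0 with hi | hi
    · have hpB : ‖p‖ ≤ D * (Q.phi y + 1) := hp.trans (by gcongr)
      exact (hx i hi p hpB).trans (mul_nonneg (by linarith) hφ)
    · linarith [c_le_phi (Q := Q) x i, mul_le_mul_of_nonneg_left (hcp i hi) ht₀.le]

theorem eventually_deltaPhi_ge (hQ : Q.IsC1) (A : Params) {y : E n} (hy : Q.EMFCQ y) :
    ∃ c : ℝ, 0 < c ∧ ∀ᶠ x in 𝓝 y, c * Q.phi x ≤ Q.deltaPhi x (A.sigma Q x) := by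
  obtain ⟨D, c, hD, hc, -, hstep⟩ := hQ.eventually_linPhi_le hy
  have hF : 0 < Q.phi y + 1 := by linarith [phi_nonneg (Q := Q) y]
  have hσ := A.σu_pos
  have hκ := A.κu_pos
  obtain ⟨t, ht₀, ht₁, htσ, htκ⟩ : ∃ t : ℝ, 0 < t ∧ t ≤ 1 ∧
      t * (D * (Q.phi y + 1)) ≤ A.σu ∧ t * D ≤ A.κu := by
    refine ⟨min 1 (min (A.σu / (D * (Q.phi y + 1))) (A.κu / D)), by positivity, min_le_left _ _,
      ?_, ?_⟩
    · rw [← le_div_iff₀ (by positivity)]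
      exact (min_le_right _ _).trans (min_le_left _ _)
    · rw [← le_div_iff₀ hD]
      exact (min_le_right _ _).trans (min_le_right _ _)
  refine ⟨c * t, by positivity, ?_⟩
  filter_upwards [hstep, hQ.eventually_phi_le y] with x ⟨p, hp, hlin⟩ hφy
  have hφ := phi_nonneg (Q := Q) x
  have hsup : supNorm (t • p) ≤ A.sigma Q x := by
    have hpφ : t * supNorm p ≤ t * (D * Q.phi x) := by
      gcongr
      exact (supNorm_le_norm p).trans hp
    rw [supNorm_smul, abs_of_pos ht₀]
    refine hpφ.trans (le_min ?_ ?_)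
    · refine le_trans ?_ htσ
      gcongr
    · rw [← mul_assoc]
      gcongr
  have hkap := (kap_le (Q := Q) x hsup).trans (linPhi_smul_le x p ht₀.le ht₁)
  rw [deltaPhi]
  linarith [mul_le_mul_of_nonneg_left hlin ht₀.le]

theorem exists_deltaPhi_ge (hQ : Q.IsC1) (A : Params) {K : Set (E n)} (hK : IsCompact K)
    (hMF : ∀ x ∈ K, Q.EMFCQ x) :
    ∃ c : ℝ, 0 < c ∧ ∀ x ∈ K, c * Q.phi x ≤ Q.deltaPhi x (A.sigma Q x) := by
  refine hK.induction_on (p := fun s => ∃ c : ℝ, 0 < c ∧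
    ∀ x ∈ s, c * Q.phi x ≤ Q.deltaPhi x (A.sigma Q x)) ⟨1, one_pos, by simp⟩ ?_ ?_ ?_
  · rintro s t hst ⟨c, hc, h⟩
    exact ⟨c, hc, fun x hx => h x (hst hx)⟩
  · rintro s t ⟨c, hc, h⟩ ⟨c', hc', h'⟩
    refine ⟨min c c', lt_min hc hc', fun x hx => ?_⟩
    have hφ := phi_nonneg (Q := Q) x
    rcases hx with hx | hx
    · exact (mul_le_mul_of_nonneg_right (min_le_left _ _) hφ).trans (h x hx)
    · exact (mul_le_mul_of_nonneg_right (min_le_right _ _) hφ).trans (h' x hx)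
  · intro y hy
    obtain ⟨c, hc, h⟩ := hQ.eventually_deltaPhi_ge A (hMF y hy)
    exact ⟨_, mem_nhdsWithin_of_mem_nhds h, c, hc, fun x hx => hx⟩

end IsC1

end Problem

/-! ### The direction-finding quadratic program -/

section Prerequisites

theorem abs_sub_sub_mul_inner_gradient_le {F : Type*} [NormedAddCommGroup F]
    [InnerProductSpace ℝ F] [CompleteSpace F] {f : F → ℝ} (hf : Differentiable ℝ f) {s : Set F}
    {L : NNReal} (hL : LipschitzOnWith L (gradient f) s) {x d : F} {α : ℝ} (hα : 0 ≤ α)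
    (hseg : ∀ t ∈ Set.Icc (0 : ℝ) α, x + t • d ∈ s) :
    |f (x + α • d) - f x - α * inner ℝ (gradient f x) d| ≤ L * (α ^ 2 * ‖d‖ ^ 2) := by
  have hderiv : ∀ t : ℝ, HasDerivAt (fun t : ℝ => f (x + t • d) - t * inner ℝ (gradient f x) d)
      (inner ℝ (gradient f (x + t • d) - gradient f x) d) t := by
    intro t
    have hline : HasDerivAt (fun t : ℝ => x + t • d) d t := by
      simpa using ((hasDerivAt_id t).smul_const d).const_add x
    have hsub := ((hf (x + t • d)).hasGradientAt.hasFDerivAt.comp_hasDerivAt t hline).sub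
      ((hasDerivAt_id t).mul_const (inner ℝ (gradient f x) d))
    rwa [InnerProductSpace.toDual_apply_apply, one_mul, ← inner_sub_left] at hsub
  have hbound : ∀ t ∈ Set.Ico (0 : ℝ) α,
      ‖inner ℝ (gradient f (x + t • d) - gradient f x) d‖ ≤ L * (α * ‖d‖ ^ 2) := by
    intro t ht
    have hx : x ∈ s := by simpa using hseg 0 ⟨le_rfl, hα⟩
    have hdist : ‖x + t • d - x‖ ≤ α * ‖d‖ := by
      rw [add_sub_cancel_left, norm_smul, Real.norm_of_nonneg ht.1]
      exact mul_le_mul_of_nonneg_right ht.2.le (norm_nonneg _)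
    calc ‖inner ℝ (gradient f (x + t • d) - gradient f x) d‖
        ≤ ‖gradient f (x + t • d) - gradient f x‖ * ‖d‖ := norm_inner_le_norm _ _
      _ ≤ L * (α * ‖d‖) * ‖d‖ := by
          gcongr
          exact (hL.norm_sub_le (hseg t ⟨ht.1, ht.2.le⟩) hx).trans (by gcongr)
      _ = L * (α * ‖d‖ ^ 2) := by ring
  have hmvt := norm_image_sub_le_of_norm_deriv_le_segment'
    (fun t _ => (hderiv t).hasDerivWithinAt) hbound α ⟨hα, le_rfl⟩
  simp only [zero_smul, add_zero, zero_mul, sub_zero, Real.norm_eq_abs] at hmvt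
  calc |f (x + α • d) - f x - α * inner ℝ (gradient f x) d|
      = |f (x + α • d) - α * inner ℝ (gradient f x) d - f x| := by congr 1; ring
    _ ≤ L * (α * ‖d‖ ^ 2) * α := hmvt
    _ = L * (α ^ 2 * ‖d‖ ^ 2) := by ring

/- Take `r = s / D`; if `s = 0`, let `r` tend to `0` instead. -/
theorem le_mul_of_forall_mul_le_mul_sq {a s D M T : ℝ} (hs : 0 ≤ s) (hsD : s ≤ D) (hD : 0 < D)
    (h : ∀ r, 0 < r → r ≤ 1 → r * a ≤ M * (s + r * T) ^ 2) : a ≤ M * (D + T) ^ 2 / D * s := by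
  rcases hs.eq_or_lt with rfl | hs
  · have hlim : Tendsto (fun r : ℝ => M * T ^ 2 * r) (𝓝[>] 0) (𝓝 0) := by
      have hcont : Continuous fun r : ℝ => M * T ^ 2 * r := by fun_prop
      simpa using (hcont.tendsto 0).mono_left nhdsWithin_le_nhds
    rw [mul_zero]
    refine ge_of_tendsto hlim ?_
    filter_upwards [Ioc_mem_nhdsGT one_pos] with r hr
    refine le_of_mul_le_mul_left ?_ hr.1
    linarith [h r hr.1 hr.2]
  · refine le_of_mul_le_mul_left ((h (s / D) (by positivity) ((div_le_one hD).2 hsD)).trans_eq ?_)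
      (by positivity : 0 < s / D)
    field_simp

end Prerequisites

namespace Problem

variable {n m₁ m₂ : ℕ} {Q : Problem n m₁ m₂}

section Taylor

variable {Ω : Set (E n)} {Lf : NNReal} {Lh : Fin m₁ → NNReal} {Lc : Fin m₂ → NNReal}

theorem RegularOn.phi_add_smul_le_linPhi_add (hΩ : Q.RegularOn Ω Lf Lh Lc) {x d : E n} {α : ℝ}
    (hα : 0 ≤ α) (hseg : ∀ t ∈ Set.Icc (0 : ℝ) α, x + t • d ∈ Ω) :
    Q.phi (x + α • d) ≤ Q.linPhi x (α • d) + Lhc Lh Lc * (α ^ 2 * ‖d‖ ^ 2) := by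
  have hL : 0 ≤ Lhc Lh Lc := NNReal.coe_nonneg _
  have hLh : ∀ i, (Lh i : ℝ) ≤ Lhc Lh Lc := fun i =>
    NNReal.coe_le_coe.2 ((Finset.le_sup (Finset.mem_univ i)).trans (le_max_left _ _))
  have hLc : ∀ i, (Lc i : ℝ) ≤ Lhc Lh Lc := fun i =>
    NNReal.coe_le_coe.2 ((Finset.le_sup (Finset.mem_univ i)).trans (le_max_right _ _))
  have hsq : 0 ≤ α ^ 2 * ‖d‖ ^ 2 := by positivity
  have hlin := linPhi_nonneg (Q := Q) x (α • d)
  obtain ⟨hh, hc⟩ := (linPhi_le_iff (Q := Q) x (α • d) hlin).1 le_rfl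
  refine (phi_le_iff _ (by positivity)).2 ⟨fun i => ?_, fun i => ?_⟩
  · have htaylor := (abs_sub_sub_mul_inner_gradient_le ((hΩ.smooth_h i).differentiable one_ne_zero)
      (hΩ.lip_h i) hα hseg).trans (mul_le_mul_of_nonneg_right (hLh i) hsq)
    have hhi := hh i
    rw [inner_smul_right] at hhi
    rw [abs_le] at htaylor hhi ⊢
    constructor <;> linarith
  · have htaylor := (abs_sub_sub_mul_inner_gradient_le ((hΩ.smooth_c i).differentiable one_ne_zero)
      (hΩ.lip_c i) hα hseg).trans (mul_le_mul_of_nonneg_right (hLc i) hsq)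
    have hci := hc i
    rw [inner_smul_right] at hci
    linarith [le_of_abs_le htaylor]

theorem RegularOn.Psi_add_smul_le (hΩ : Q.RegularOn Ω Lf Lh Lc) {x d : E n} {α σ ρ : ℝ}
    (hρ : 0 ≤ ρ) (hα₀ : 0 ≤ α) (hα₁ : α ≤ 1) (hseg : ∀ t ∈ Set.Icc (0 : ℝ) α, x + t • d ∈ Ω)
    (hd : Q.linPhi x d ≤ Q.kap x σ) :
    Q.Psi ρ (x + α • d) ≤ Q.Psi ρ x
      + α * (inner ℝ (gradient Q.f x) d - ρ * Q.deltaPhi x σ)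
      + (Lf + ρ * Lhc Lh Lc) * (α ^ 2 * ‖d‖ ^ 2) := by
  have hf := le_of_abs_le (abs_sub_sub_mul_inner_gradient_le
    (hΩ.smooth_f.differentiable one_ne_zero) hΩ.lip_f hα₀ hseg)
  have hφ : Q.phi (x + α • d) ≤
      Q.phi x - α * Q.deltaPhi x σ + Lhc Lh Lc * (α ^ 2 * ‖d‖ ^ 2) := by
    rw [deltaPhi]
    linarith [hΩ.phi_add_smul_le_linPhi_add hα₀ hseg, linPhi_smul_le (Q := Q) x d hα₀ hα₁,
      mul_le_mul_of_nonneg_left hd hα₀]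
  rw [Psi, Psi]
  linarith [mul_le_mul_of_nonneg_left hφ hρ]

end Taylor

theorem phi_le_linPhi_add (x d : E n) {G : ℝ} (hG : 0 ≤ G)
    (hh : ∀ i, ‖gradient (Q.h i) x‖ ≤ G) (hc : ∀ i, ‖gradient (Q.c i) x‖ ≤ G) :
    Q.phi x ≤ Q.linPhi x d + G * ‖d‖ := by
  have hinner : ∀ v : E n, ‖v‖ ≤ G → |inner ℝ v d| ≤ G * ‖d‖ := fun v hv =>
    (abs_real_inner_le_norm v d).trans (mul_le_mul_of_nonneg_right hv (norm_nonneg _))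
  have hl := linPhi_nonneg (Q := Q) x d
  obtain ⟨hlh, hlc⟩ := (linPhi_le_iff (Q := Q) x d hl).1 le_rfl
  refine (phi_le_iff x (by positivity)).2 ⟨fun i => ?_, fun i => ?_⟩
  · have hi := hinner _ (hh i)
    have hli := hlh i
    rw [abs_le] at hi hli ⊢
    constructor <;> linarith
  · linarith [hlc i, neg_le_of_abs_le (hinner _ (hc i))]

theorem chi_le_mul {βl : ℝ} (hβ : 0 ≤ βl) (x : E n) :
    Q.chi βl x ≤ ‖gradient Q.f x‖ * (Real.sqrt n * (βl / 2)) := by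
  obtain ⟨t, ⟨-, -, ht⟩, hχ⟩ := exists_chi_eq (Q := Q) hβ x
  rw [hχ]
  refine (neg_le_abs _).trans ((abs_real_inner_le_norm _ _).trans ?_)
  gcongr
  exact (norm_le_sqrt_mul_supNorm t).trans (by gcongr)

theorem IsC1.exists_norm_gradient_le (hQ : Q.IsC1) {K : Set (E n)} (hK : IsCompact K) :
    ∃ G : ℝ, 0 ≤ G ∧ ∀ x ∈ K, ‖gradient Q.f x‖ ≤ G ∧ (∀ i, ‖gradient (Q.h i) x‖ ≤ G) ∧
      ∀ i, ‖gradient (Q.c i) x‖ ≤ G := by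
  have hcont : Continuous fun x =>
      (gradient Q.f x, (fun i => gradient (Q.h i) x), fun i => gradient (Q.c i) x) :=
    (continuous_gradient hQ.f).prodMk ((continuous_pi fun i => continuous_gradient (hQ.h i)).prodMk
      (continuous_pi fun i => continuous_gradient (hQ.c i)))
  obtain ⟨G, hG⟩ := hK.exists_bound_of_continuousOn hcont.continuousOn
  refine ⟨max G 0, le_max_right _ _, fun x hx => ?_⟩
  have hx' := (hG x hx).trans (le_max_left G 0)
  rw [norm_prod_le_iff, norm_prod_le_iff] at hx'
  exact ⟨hx'.1, fun i => (norm_le_pi_norm (fun i => gradient (Q.h i) x) i).trans hx'.2.1,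
    fun i => (norm_le_pi_norm (fun i => gradient (Q.c i) x) i).trans hx'.2.2⟩

theorem IsC1.exists_stationarity_le (hQ : Q.IsC1) {K : Set (E n)} (hK : IsCompact K) {βl : ℝ}
    (hβ : 0 ≤ βl) : ∃ C : ℝ, ∀ x ∈ K, Q.phi x ^ 2 + Q.chi βl x ^ 2 ≤ C := by
  obtain ⟨G, -, hG⟩ := hQ.exists_norm_gradient_le hK
  obtain ⟨F, hF⟩ := hK.exists_bound_of_continuousOn hQ.continuous_phi.continuousOn
  refine ⟨F ^ 2 + (G * (Real.sqrt n * (βl / 2))) ^ 2, fun x hx => ?_⟩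
  have hφ : Q.phi x ≤ F := le_of_abs_le (hF x hx)
  have hχ : Q.chi βl x ≤ G * (Real.sqrt n * (βl / 2)) :=
    (chi_le_mul hβ x).trans (mul_le_mul_of_nonneg_right (hG x hx).1 (by positivity))
  have hφ₀ := phi_nonneg (Q := Q) x
  have hχ₀ := chi_nonneg (Q := Q) hβ x
  gcongr

theorem add_smul_mem_qpFeasible {x d t : E n} {κ β βl r : ℝ} (hd : d ∈ Q.qpFeasible x κ β)
    (hdl : supNorm d ≤ βl / 2) (ht : t ∈ Q.chiFeasible βl x) (hβ : βl ≤ β) (hr₀ : 0 ≤ r)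
    (hr₁ : r ≤ 1) : d + r • t ∈ Q.qpFeasible x κ β := by
  refine ⟨fun i => ?_, fun i => ?_, ?_⟩
  · rw [inner_add_right, inner_smul_right, ht.1 i, mul_zero, add_zero]
    exact hd.1 i
  · rw [inner_add_right, inner_smul_right]
    linarith [hd.2.1 i, mul_nonpos_of_nonneg_of_nonpos hr₀ (ht.2.1 i)]
  · refine (supNorm_add_le _ _).trans ?_
    rw [supNorm_smul, abs_of_nonneg hr₀]
    linarith [mul_le_of_le_one_left (supNorm_nonneg t) hr₁, ht.2.2]

/-- `d` solves the direction-finding quadratic program at `x`, with relaxation `κ`, radius `β`,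
gradient estimate `g` and Hessian model `H`. -/
structure IsQPSolution (Q : Problem n m₁ m₂) (x : E n) (κ β : ℝ) (g : E n)
    (H : Matrix (Fin n) (Fin n) ℝ) (d : E n) : Prop where
  mem : d ∈ Q.qpFeasible x κ β
  isMinOn : IsMinOn (fun v => inner ℝ g v + 1 / 2 * quad H v) (Q.qpFeasible x κ β) d

namespace IsQPSolution

variable {x g d : E n} {κ β : ℝ} {H : Matrix (Fin n) (Fin n) ℝ}

theorem norm_le (hd : Q.IsQPSolution x κ β g H d) : ‖d‖ ≤ Real.sqrt n * β :=
  (norm_le_sqrt_mul_supNorm d).trans (mul_le_mul_of_nonneg_left hd.mem.2.2 (Real.sqrt_nonneg _))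

/- Compare `d` with a minimizer of the linearized infeasibility, whose length is at most `√n σ`. -/
theorem objective_le {σ ζ MH : ℝ} (hd : Q.IsQPSolution x (Q.kap x σ) β g H d) (hσ : 0 ≤ σ)
    (hσβ : σ ≤ β) (hg : ‖g‖ ≤ ζ) (hMH : 0 ≤ MH) (hH : ∀ v, quad H v ≤ MH * ‖v‖ ^ 2) :
    inner ℝ g d + 1 / 2 * quad H d ≤ (ζ * Real.sqrt n + 1 / 2 * MH * n * σ) * σ := by
  obtain ⟨p, hp, hpκ⟩ := (isLeast_kap (Q := Q) x hσ).1
  have hmin : inner ℝ g d + 1 / 2 * quad H d ≤ inner ℝ g p + 1 / 2 * quad H p :=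
    hd.isMinOn ((mem_qpFeasible_iff x p (kap_nonneg x _)).2 ⟨hpκ.le, le_trans hp hσβ⟩)
  have hpσ : ‖p‖ ≤ Real.sqrt n * σ :=
    (norm_le_sqrt_mul_supNorm p).trans (mul_le_mul_of_nonneg_left hp (Real.sqrt_nonneg _))
  have hinner : inner ℝ g p ≤ ζ * (Real.sqrt n * σ) := by
    refine (real_inner_le_norm _ _).trans ?_
    have hζ : 0 ≤ ζ := (norm_nonneg g).trans hg
    gcongr
  have hquad : quad H p ≤ MH * (Real.sqrt n * σ) ^ 2 := (hH p).trans (by gcongr)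
  rw [mul_pow, Real.sq_sqrt (by positivity)] at hquad
  linarith

/- The trial step `d + r t` is feasible for every `t` that is feasible for the linear program of
`χ`; compare its objective with that of `d`. -/
theorem neg_inner_le {t : E n} {βl D T MH : ℝ} (hd : Q.IsQPSolution x κ β g H d)
    (hdl : supNorm d ≤ βl / 2) (hβ : βl ≤ β) (ht : t ∈ Q.chiFeasible βl x) (hT : ‖t‖ ≤ T)
    (hdD : ‖d‖ ≤ D) (hD : 0 < D) (hMH : 0 ≤ MH) (hH₀ : 0 ≤ quad H d)
    (hH : ∀ v, quad H v ≤ MH * ‖v‖ ^ 2) :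
    -inner ℝ g t ≤ 1 / 2 * MH * (D + T) ^ 2 / D * ‖d‖ := by
  refine le_mul_of_forall_mul_le_mul_sq (norm_nonneg d) hdD hD fun r hr₀ hr₁ => ?_
  have hmin : inner ℝ g d + 1 / 2 * quad H d
      ≤ inner ℝ g (d + r • t) + 1 / 2 * quad H (d + r • t) :=
    hd.isMinOn (add_smul_mem_qpFeasible hd.mem hdl ht hβ hr₀.le hr₁)
  rw [inner_add_right, inner_smul_right] at hmin
  have hnorm : ‖d + r • t‖ ≤ ‖d‖ + r * T := by
    refine (norm_add_le _ _).trans ?_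
    rw [norm_smul, Real.norm_of_nonneg hr₀.le]
    gcongr
  have hquad : quad H (d + r • t) ≤ MH * (‖d‖ + r * T) ^ 2 := (hH _).trans (by gcongr)
  linarith

/- If `‖d‖_∞ > β_l / 2`, then `‖d‖` is bounded below; otherwise `d` can still be moved in every
direction that is feasible for `χ`. -/
theorem chi_le {βl D G δ MH : ℝ} (hd : Q.IsQPSolution x κ β g H d) (hβl : 0 ≤ βl) (hβ : βl ≤ β)
    (hdD : ‖d‖ ≤ D) (hD : 0 < D) (hMH : 0 ≤ MH) (hH₀ : 0 ≤ quad H d)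
    (hH : ∀ v, quad H v ≤ MH * ‖v‖ ^ 2) (hG : ‖gradient Q.f x‖ ≤ G) (hδ : 0 ≤ δ)
    (hg : ‖g - gradient Q.f x‖ ≤ δ * ‖d‖) :
    Q.chi βl x ≤ (G * Real.sqrt n + (1 / 2 * MH * (D + Real.sqrt n * (βl / 2)) ^ 2 / D
      + δ * (Real.sqrt n * (βl / 2)))) * ‖d‖ := by
  set T : ℝ := Real.sqrt n * (βl / 2)
  have hG₀ : 0 ≤ G := (norm_nonneg _).trans hG
  rcases lt_or_ge (βl / 2) (supNorm d) with hlong | hshort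
  · have hβd : βl / 2 ≤ ‖d‖ := hlong.le.trans (supNorm_le_norm d)
    have hχ : Q.chi βl x ≤ G * (Real.sqrt n * ‖d‖) := (chi_le_mul hβl x).trans (by gcongr)
    have hrest : 0 ≤ (1 / 2 * MH * (D + T) ^ 2 / D + δ * T) * ‖d‖ := by positivity
    linarith
  · obtain ⟨t, ht, hχ⟩ := exists_chi_eq (Q := Q) hβl x
    have htT : ‖t‖ ≤ T := (norm_le_sqrt_mul_supNorm t).trans
      (mul_le_mul_of_nonneg_left ht.2.2 (Real.sqrt_nonneg _))
    have hmodel := hd.neg_inner_le hshort hβ ht htT hdD hD hMH hH₀ hH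
    have herror : inner ℝ (g - gradient Q.f x) t ≤ δ * ‖d‖ * T := by
      refine (real_inner_le_norm _ _).trans ?_
      gcongr
    rw [inner_sub_left] at herror
    have hrest : 0 ≤ G * Real.sqrt n * ‖d‖ := by positivity
    rw [hχ]
    linarith

end IsQPSolution

namespace IsC1

variable {K : Set (E n)}

theorem exists_penalty (hQ : Q.IsC1) (A : Params) (hK : IsCompact K) (hMF : ∀ x ∈ K, Q.EMFCQ x)
    {MH : ℝ} (hMH : 0 ≤ MH) :
    ∃ ρs : ℝ, 0 < ρs ∧ ∀ x ∈ K, ∀ (g d : E n) (H : Matrix (Fin n) (Fin n) ℝ) (β ρ : ℝ),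
      ‖g‖ ≤ A.ζ₀ → (∀ v, quad H v ≤ MH * ‖v‖ ^ 2) → A.βl ≤ β →
      Q.IsQPSolution x (Q.kap x (A.sigma Q x)) β g H d → ρs ≤ ρ →
      1 / 2 * quad H d ≤ -inner ℝ g d + ρ * Q.deltaPhi x (A.sigma Q x) := by
  obtain ⟨c, hc, hcK⟩ := hQ.exists_deltaPhi_ge A hK hMF
  have hσu := A.σu_pos
  have hκu := A.κu_pos
  have hζ := A.ζ₀_pos
  set C : ℝ := A.ζ₀ * Real.sqrt n + 1 / 2 * MH * n * A.σu + 1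
  have hC₀ : 0 < C := by positivity
  refine ⟨C * A.κu / c, by positivity, fun x hx g d H β ρ hg hH hβ hd hρ => ?_⟩
  have hφ := phi_nonneg (Q := Q) x
  have hσ := sigma_nonneg (Q := Q) A x
  have hσu' : A.sigma Q x ≤ A.σu := min_le_left _ _
  have hobj := hd.objective_le hσ (by linarith [A.βl_gt]) hg hMH hH
  have hmodel : (A.ζ₀ * Real.sqrt n + 1 / 2 * MH * n * A.sigma Q x) * A.sigma Q x ≤
      ρ * Q.deltaPhi x (A.sigma Q x) := by
    calc (A.ζ₀ * Real.sqrt n + 1 / 2 * MH * n * A.sigma Q x) * A.sigma Q x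
        ≤ C * (A.κu * Q.phi x) := by
          gcongr
          · exact (add_le_add_right (by gcongr) _).trans (lt_add_one _).le
          · exact min_le_right _ _
      _ = C * A.κu / c * (c * Q.phi x) := by field_simp
      _ ≤ ρ * Q.deltaPhi x (A.sigma Q x) :=
          mul_le_mul hρ (hcK x hx) (by positivity) ((by positivity : 0 ≤ C * A.κu / c).trans hρ)
  linarith

theorem exists_phi_le_mul_norm (hQ : Q.IsC1) (A : Params) (hK : IsCompact K)
    (hMF : ∀ x ∈ K, Q.EMFCQ x) :
    ∃ C : ℝ, ∀ x ∈ K, ∀ d : E n, Q.linPhi x d ≤ Q.kap x (A.sigma Q x) → Q.phi x ≤ C * ‖d‖ := by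
  obtain ⟨c, hc, hcK⟩ := hQ.exists_deltaPhi_ge A hK hMF
  obtain ⟨G, hG, hGK⟩ := hQ.exists_norm_gradient_le hK
  refine ⟨G / c, fun x hx d hd => ?_⟩
  have hφ := phi_le_linPhi_add (Q := Q) x d hG (hGK x hx).2.1 (hGK x hx).2.2
  have hΔ := hcK x hx
  rw [deltaPhi] at hΔ
  rw [div_mul_eq_mul_div, le_div_iff₀ hc]
  linarith

theorem exists_chi_le_mul_norm (hQ : Q.IsC1) (A : Params) (hK : IsCompact K) {MH δ : ℝ}
    (hMH : 0 ≤ MH) (hδ : 0 ≤ δ) :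
    ∃ C : ℝ, ∀ x ∈ K, ∀ (g d : E n) (H : Matrix (Fin n) (Fin n) ℝ) (κ β : ℝ),
      (∀ v, 0 ≤ quad H v ∧ quad H v ≤ MH * ‖v‖ ^ 2) → β ∈ Set.Icc A.βl A.βu →
      Q.IsQPSolution x κ β g H d → ‖g - gradient Q.f x‖ ≤ δ * ‖d‖ → Q.chi A.βl x ≤ C * ‖d‖ := by
  obtain ⟨G, -, hG⟩ := hQ.exists_norm_gradient_le hK
  have hβl : 0 < A.βl := by linarith [A.βl_gt, A.σu_pos]
  have hβu : 0 < A.βu := by linarith [A.βu_gt]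
  refine ⟨_, fun x hx g d H κ β hH hβ hd hg => hd.chi_le hβl.le hβ.1 (D := Real.sqrt n * A.βu + 1)
    (hd.norm_le.trans ?_) (by positivity) hMH (hH d).1 (fun v => (hH v).2) (hG x hx).1 hδ hg⟩
  exact (mul_le_mul_of_nonneg_left hβ.2 (Real.sqrt_nonneg _)).trans (lt_add_one _).le

theorem exists_stationarity_le_mul_sq (hQ : Q.IsC1) (A : Params) (hK : IsCompact K)
    (hMF : ∀ x ∈ K, Q.EMFCQ x) {MH δ : ℝ} (hMH : 0 ≤ MH) (hδ : 0 ≤ δ) :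
    ∃ C : ℝ, 0 < C ∧ ∀ x ∈ K, ∀ (g d : E n) (H : Matrix (Fin n) (Fin n) ℝ) (β : ℝ),
      (∀ v, 0 ≤ quad H v ∧ quad H v ≤ MH * ‖v‖ ^ 2) → β ∈ Set.Icc A.βl A.βu →
      Q.IsQPSolution x (Q.kap x (A.sigma Q x)) β g H d → ‖g - gradient Q.f x‖ ≤ δ * ‖d‖ →
      Q.phi x ^ 2 + Q.chi A.βl x ^ 2 ≤ C * ‖d‖ ^ 2 := by
  obtain ⟨C₁, hC₁⟩ := hQ.exists_phi_le_mul_norm A hK hMF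
  obtain ⟨C₂, hC₂⟩ := hQ.exists_chi_le_mul_norm A hK hMH hδ
  refine ⟨C₁ ^ 2 + C₂ ^ 2 + 1, by positivity, fun x hx g d H β hH hβ hd hg => ?_⟩
  have hβl : 0 < A.βl := by linarith [A.βl_gt, A.σu_pos]
  have hφ := pow_le_pow_left₀ (phi_nonneg x)
    (hC₁ x hx d ((mem_qpFeasible_iff x d (kap_nonneg x _)).1 hd.mem).1) 2
  have hχ := pow_le_pow_left₀ (chi_nonneg hβl.le x) (hC₂ x hx g d H _ β hH hβ hd hg) 2
  rw [mul_pow] at hφ hχ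
  linarith [sq_nonneg ‖d‖]

end IsC1

end Problem

/-! ### Conditional expectations and hitting times -/

section ConditionalExpectation

variable {S : Type*} {m m' mS : MeasurableSpace S} {μ : Measure S}

theorem setIntegral_le_of_condExp_le [IsFiniteMeasure μ] (hm : m ≤ mS) {X Z : S → ℝ}
    (hX : Integrable X μ) (hZ : Integrable Z μ) (h : μ[X | m] ≤ᵐ[μ] Z) {B : Set S}
    (hB : MeasurableSet[m] B) : ∫ ω in B, X ω ∂μ ≤ ∫ ω in B, Z ω ∂μ :=
  (setIntegral_condExp hm hX hB).symm.trans_le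
    (setIntegral_mono_ae integrable_condExp.integrableOn hZ.integrableOn h)

theorem setIntegral_le_of_le_condExp [IsFiniteMeasure μ] (hm : m ≤ mS) {X Z : S → ℝ}
    (hX : Integrable X μ) (hZ : Integrable Z μ) (h : Z ≤ᵐ[μ] μ[X | m]) {B : Set S}
    (hB : MeasurableSet[m] B) : ∫ ω in B, Z ω ∂μ ≤ ∫ ω in B, X ω ∂μ :=
  (setIntegral_mono_ae hZ.integrableOn integrable_condExp.integrableOn h).trans_eq
    (setIntegral_condExp hm hX hB)

theorem mul_le_condExp_indicator [IsFiniteMeasure μ] {p : ℝ} {A : Set S} (hA : MeasurableSet A)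
    (hp : ∀ᵐ ω ∂μ, p ≤ (μ[A.indicator fun _ => (1 : ℝ) | m]) ω) {W : S → ℝ}
    (hWm : Measurable[m] W) (hW : Integrable W μ) (hW₀ : 0 ≤ W) :
    (fun ω => p * W ω) ≤ᵐ[μ] μ[A.indicator W | m] := by
  have hprod : W * A.indicator (fun _ => (1 : ℝ)) = A.indicator W := by
    ext ω
    by_cases hω : ω ∈ A <;> simp [hω]
  have hpull := condExp_mul_of_stronglyMeasurable_left (m := m) (μ := μ) hWm.stronglyMeasurable
    (hprod ▸ hW.indicator hA) ((integrable_const (1 : ℝ)).indicator hA)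
  rw [hprod] at hpull
  filter_upwards [hpull, hp] with ω hω hpω
  rw [hω, Pi.mul_apply, mul_comm p]
  exact mul_le_mul_of_nonneg_left hpω (hW₀ ω)

theorem mul_le_condExp_indicator_inter [IsFiniteMeasure μ] (hm : m ≤ m') (hm' : m' ≤ mS)
    {p q : ℝ} {I J : Set S} (hI : MeasurableSet[m'] I) (hJ : MeasurableSet J) (hq : 0 ≤ q)
    (hpI : ∀ᵐ ω ∂μ, p ≤ (μ[I.indicator fun _ => (1 : ℝ) | m]) ω)
    (hqJ : ∀ᵐ ω ∂μ, q ≤ (μ[J.indicator fun _ => (1 : ℝ) | m']) ω) :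
    ∀ᵐ ω ∂μ, q * p ≤ (μ[(I ∩ J).indicator fun _ => (1 : ℝ) | m]) ω := by
  have hInt : Integrable (I.indicator fun _ => (1 : ℝ)) μ :=
    (integrable_const _).indicator (hm' _ hI)
  have hcond := mul_le_condExp_indicator hJ hqJ
    (measurable_const.indicator hI) hInt (Set.indicator_nonneg fun _ _ => zero_le_one)
  rw [Set.indicator_indicator, Set.inter_comm] at hcond
  have hmono := condExp_mono (m := m) (hInt.const_mul q) integrable_condExp hcond
  filter_upwards [hmono, condExp_condExp_of_le (f := (I ∩ J).indicator fun _ => (1 : ℝ)) hm hm',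
    condExp_smul (μ := μ) q (I.indicator fun _ => (1 : ℝ)) m, hpI] with ω hle htower hsmul hp
  calc q * p ≤ q * (μ[I.indicator fun _ => (1 : ℝ) | m]) ω := mul_le_mul_of_nonneg_left hp hq
    _ = (μ[q • I.indicator fun _ => (1 : ℝ) | m]) ω := hsmul.symm
    _ ≤ _ := hle.trans_eq htower

theorem measure_eq_zero_of_measure_inter_eq_zero [IsFiniteMeasure μ] (hm : m ≤ mS) {p : ℝ}
    (hp : 0 < p) {A B : Set S} (hA : MeasurableSet A) (hB : MeasurableSet[m] B)
    (hpA : ∀ᵐ ω ∂μ, p ≤ (μ[A.indicator fun _ => (1 : ℝ) | m]) ω) (h : μ (B ∩ A) = 0) :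
    μ B = 0 := by
  have hle := setIntegral_le_of_le_condExp hm ((integrable_const (1 : ℝ)).indicator hA)
    (integrable_const p) hpA hB
  rw [setIntegral_indicator hA, setIntegral_const, setIntegral_const, measureReal_def,
    measureReal_def, h, ENNReal.toReal_zero, zero_smul, smul_eq_mul] at hle
  have hzero : (μ B).toReal = 0 :=
    le_antisymm (nonpos_of_mul_nonpos_left hle hp) ENNReal.toReal_nonneg
  exact ((ENNReal.toReal_eq_zero_iff _).1 hzero).resolve_right (measure_ne_top _ _)

/- Conditional expectations are only defined almost everywhere, so nonnegativity of
`E[(sX - Y)² | m]` is used for rational `s` and extended to real `s` by density. -/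
theorem sq_condExp_mul_le {X Y : S → ℝ} (hX : MemLp X 2 μ) (hY : MemLp Y 2 μ) :
    ∀ᵐ ω ∂μ, (μ[fun ω => X ω * Y ω | m]) ω ^ 2 ≤
      (μ[fun ω => X ω ^ 2 | m]) ω * (μ[fun ω => Y ω ^ 2 | m]) ω := by
  have hXY : Integrable (fun ω => X ω * Y ω) μ := hX.integrable_mul hY
  have hquad (s : ℚ) : ∀ᵐ ω ∂μ, 0 ≤ (μ[fun ω => X ω ^ 2 | m]) ω * (s * s)
      + -2 * (μ[fun ω => X ω * Y ω | m]) ω * s + (μ[fun ω => Y ω ^ 2 | m]) ω := by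
    have hexpand : (fun ω => ((s : ℝ) * X ω - Y ω) ^ 2) = ((s : ℝ) * s) • (fun ω => X ω ^ 2)
        - (2 * (s : ℝ)) • (fun ω => X ω * Y ω) + fun ω => Y ω ^ 2 := by
      ext ω
      simp only [Pi.add_apply, Pi.sub_apply, Pi.smul_apply, smul_eq_mul]
      ring
    have hnonneg : 0 ≤ᵐ[μ] μ[fun ω => ((s : ℝ) * X ω - Y ω) ^ 2 | m] :=
      condExp_nonneg (ae_of_all _ fun ω => sq_nonneg _)
    rw [hexpand] at hnonneg
    filter_upwards [hnonneg,
      condExp_add ((hX.integrable_sq.smul ((s : ℝ) * s)).sub (hXY.smul (2 * (s : ℝ))))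
        hY.integrable_sq m,
      condExp_sub (hX.integrable_sq.smul ((s : ℝ) * s)) (hXY.smul (2 * (s : ℝ))) m,
      condExp_smul (μ := μ) ((s : ℝ) * s) (fun ω => X ω ^ 2) m,
      condExp_smul (μ := μ) (2 * (s : ℝ)) (fun ω => X ω * Y ω) m] with ω h₀ h₁ h₂ h₃ h₄
    simp only [Pi.zero_apply, h₁, h₂, h₃, h₄, Pi.add_apply, Pi.sub_apply, Pi.smul_apply,
      smul_eq_mul] at h₀
    linarith
  filter_upwards [ae_all_iff.2 hquad] with ω hω
  have hreal (s : ℝ) : 0 ≤ (μ[fun ω => X ω ^ 2 | m]) ω * (s * s)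
      + -2 * (μ[fun ω => X ω * Y ω | m]) ω * s + (μ[fun ω => Y ω ^ 2 | m]) ω :=
    Rat.denseRange_cast.induction_on s (isClosed_le continuous_const (by fun_prop)) hω
  have hdiscr := discrim_le_zero hreal
  unfold discrim at hdiscr
  linarith

theorem condExp_indicator_compl_abs_le [IsFiniteMeasure μ] (hm : m ≤ mS) {J : Set S}
    (hJ : MeasurableSet J) {q : ℝ}
    (hq : ∀ᵐ ω ∂μ, q ≤ (μ[J.indicator fun _ => (1 : ℝ) | m]) ω) {X Z : S → ℝ}
    (hX : MemLp X 2 μ) (hZ : 0 ≤ Z) (hXZ : ∀ᵐ ω ∂μ, (μ[fun ω => |X ω| ^ 2 | m]) ω ≤ Z ω ^ 2) :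
    μ[Jᶜ.indicator fun ω => |X ω| | m] ≤ᵐ[μ] fun ω => √(1 - q) * Z ω := by
  set χ : S → ℝ := Jᶜ.indicator fun _ => (1 : ℝ)
  have hχ : MemLp χ 2 μ := memLp_indicator_const 2 hJ.compl 1 (Or.inr (measure_ne_top _ _))
  have hmul : (Jᶜ.indicator fun ω => |X ω|) = fun ω => |X ω| * χ ω := by
    ext ω
    by_cases hω : ω ∈ Jᶜ <;> simp [χ, hω]
  have hsq : (fun ω => χ ω ^ 2) = (fun _ => 1) - J.indicator fun _ => (1 : ℝ) := by
    ext ω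
    by_cases hω : ω ∈ J <;> simp [χ, hω]
  have hcompl := condExp_sub (integrable_const (1 : ℝ)) ((integrable_const (1 : ℝ)).indicator hJ)
    (μ := μ) m
  rw [← hsq, condExp_const hm] at hcompl
  have hsq_nonneg : 0 ≤ᵐ[μ] μ[fun ω => χ ω ^ 2 | m] :=
    condExp_nonneg (ae_of_all _ fun ω => sq_nonneg _)
  rw [hmul]
  filter_upwards [sq_condExp_mul_le (m := m) hX.abs hχ, hcompl, hq, hXZ, hsq_nonneg]
    with ω hcs hcompl hq hXZ hnonneg
  simp only [Pi.sub_apply] at hcompl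
  have hle : (μ[fun ω => χ ω ^ 2 | m]) ω ≤ 1 - q := by linarith
  refine le_of_sq_le_sq ?_ (mul_nonneg (Real.sqrt_nonneg _) (hZ ω))
  calc _ ≤ _ := hcs
    _ ≤ Z ω ^ 2 * (1 - q) := mul_le_mul hXZ hle hnonneg (sq_nonneg _)
    _ = (√(1 - q) * Z ω) ^ 2 := by rw [mul_pow, Real.sq_sqrt (hnonneg.trans hle)]; ring

theorem condExp_indicator_compl_abs_le_of_le [IsFiniteMeasure μ] (hm : m ≤ m') (hm' : m' ≤ mS)
    {J : Set S} (hJ : MeasurableSet J) {q : ℝ}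
    (hq : ∀ᵐ ω ∂μ, q ≤ (μ[J.indicator fun _ => (1 : ℝ) | m']) ω) {X Z : S → ℝ}
    (hX : MemLp X 2 μ) (hZm : Measurable[m] Z) (hZi : Integrable Z μ) (hZ : 0 ≤ Z)
    (hXZ : ∀ᵐ ω ∂μ, (μ[fun ω => |X ω| ^ 2 | m']) ω ≤ Z ω ^ 2) :
    μ[Jᶜ.indicator fun ω => |X ω| | m] ≤ᵐ[μ] fun ω => √(1 - q) * Z ω := by
  have hmono := condExp_mono (m := m) integrable_condExp (hZi.const_mul _)
    (condExp_indicator_compl_abs_le hm' hJ hq hX hZ hXZ)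
  rw [condExp_of_stronglyMeasurable (hm.trans hm') (hZm.const_mul _).stronglyMeasurable
    (hZi.const_mul _)] at hmono
  exact (condExp_condExp_of_le hm hm').symm.le.trans hmono

end ConditionalExpectation

section HittingTime

variable {S : Type*}

/-- The event that `e₀, …, e_k` are all at least `ε`, so that `e` has not dropped below `ε` by
time `k`. -/
def notYet (e : ℕ → S → ℝ) (ε : ℝ) (k : ℕ) : Set S := {ω | ∀ j ≤ k, ε ≤ e j ω}

theorem measurableSet_notYet {mS : MeasurableSpace S} {𝓕 : Filtration ℕ mS} {e : ℕ → S → ℝ}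
    (he : ∀ k, Measurable[𝓕 k] (e k)) (ε : ℝ) (k : ℕ) : MeasurableSet[𝓕 k] (notYet e ε k) := by
  have hinter : notYet e ε k = ⋂ j, ⋂ (_ : j ≤ k), {ω | ε ≤ e j ω} := by
    ext ω
    simp [notYet]
  rw [hinter]
  exact MeasurableSet.iInter fun j => MeasurableSet.iInter fun hj =>
    𝓕.mono hj _ (he j measurableSet_Ici)

theorem antitone_notYet (e : ℕ → S → ℝ) (ε : ℝ) : Antitone (notYet e ε) :=
  fun _ _ hij _ hω l hl => hω l (hl.trans hij)

theorem iInf_le_tsum_indicator_notYet (e : ℕ → S → ℝ) (ε : ℝ) (ω : S) :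
    ⨅ (k : ℕ) (_ : e k ω < ε), (k : ENNReal)
      ≤ ∑' k, (notYet e ε k).indicator (fun _ => (1 : ENNReal)) ω := by
  classical
  by_cases hhit : ∃ k, e k ω < ε
  · have hone : ∀ k ∈ Finset.range (Nat.find hhit),
        (notYet e ε k).indicator (fun _ => (1 : ENNReal)) ω = 1 := fun k hk =>
      Set.indicator_of_mem (s := notYet e ε k) (fun _ hj =>
        not_lt.1 (Nat.find_min hhit (hj.trans_lt (Finset.mem_range.1 hk)))) _
    calc ⨅ (k : ℕ) (_ : e k ω < ε), (k : ENNReal)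
        ≤ Nat.find hhit := iInf₂_le (Nat.find hhit) (Nat.find_spec hhit)
      _ = ∑ k ∈ Finset.range (Nat.find hhit),
            (notYet e ε k).indicator (fun _ => (1 : ENNReal)) ω := by
          rw [Finset.sum_congr rfl hone]
          simp
      _ ≤ _ := ENNReal.sum_le_tsum _
  · push Not at hhit
    have hone (k : ℕ) : (notYet e ε k).indicator (fun _ => (1 : ENNReal)) ω = 1 :=
      Set.indicator_of_mem (s := notYet e ε k) (fun j _ => hhit j) _
    simp only [hone, ENNReal.tsum_const_eq_top_of_ne_zero one_ne_zero, le_top]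

theorem lintegral_iInf_le_of_sum_notYet_le {mS : MeasurableSpace S} {μ : Measure S}
    [IsFiniteMeasure μ] {e : ℕ → S → ℝ} {ε C : ℝ} (hmeas : ∀ k, MeasurableSet (notYet e ε k))
    (hC : ∀ N, ∑ k ∈ Finset.range N, μ.real (notYet e ε k) ≤ C) :
    ∫⁻ ω, ⨅ (k : ℕ) (_ : e k ω < ε), (k : ENNReal) ∂μ ≤ ENNReal.ofReal C := by
  calc _ ≤ ∫⁻ ω, ∑' k, (notYet e ε k).indicator (fun _ => (1 : ENNReal)) ω ∂μ :=
        lintegral_mono fun ω => iInf_le_tsum_indicator_notYet e ε ω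
    _ = ∑' k, μ (notYet e ε k) := by
        rw [lintegral_tsum fun k => (measurable_const.indicator (hmeas k)).aemeasurable]
        simp only [lintegral_indicator (hmeas _), lintegral_const, one_mul, Measure.restrict_apply,
          MeasurableSet.univ, Set.univ_inter]
    _ ≤ ENNReal.ofReal C := by
        refine ENNReal.tsum_le_of_sum_range_le fun N => ?_
        calc ∑ k ∈ Finset.range N, μ (notYet e ε k)
            = ∑ k ∈ Finset.range N, ENNReal.ofReal (μ.real (notYet e ε k)) :=
              Finset.sum_congr rfl fun k _ => (ofReal_measureReal (measure_ne_top _ _)).symm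
          _ = ENNReal.ofReal (∑ k ∈ Finset.range N, μ.real (notYet e ε k)) :=
              (ENNReal.ofReal_sum_of_nonneg fun _ _ => measureReal_nonneg).symm
          _ ≤ ENNReal.ofReal C := ENNReal.ofReal_le_ofReal (hC N)

theorem mul_sum_measureReal_le_of_drift {mS : MeasurableSpace S} {μ : Measure S} {V : ℕ → S → ℝ}
    {B : ℕ → Set S} {δ : ℝ} (hB : Antitone B) (hV : ∀ k, Integrable (V k) μ)
    (hV₀ : ∀ k, 0 ≤ᵐ[μ] V k)
    (hdrift : ∀ k, ∫ ω in B k, V (k + 1) ω ∂μ ≤ ∫ ω in B k, V k ω ∂μ - δ * μ.real (B k)) (N : ℕ) :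
    δ * ∑ k ∈ Finset.range N, μ.real (B k) ≤ ∫ ω, V 0 ω ∂μ := by
  have htelescope (N : ℕ) : δ * ∑ k ∈ Finset.range N, μ.real (B k) + ∫ ω in B N, V N ω ∂μ
      ≤ ∫ ω, V 0 ω ∂μ := by
    induction N with
    | zero => simpa using setIntegral_le_integral (hV 0) (hV₀ 0)
    | succ N ih =>
      have hmono : ∫ ω in B (N + 1), V (N + 1) ω ∂μ ≤ ∫ ω in B N, V (N + 1) ω ∂μ :=
        setIntegral_mono_set (hV (N + 1)).integrableOn (ae_restrict_of_ae (hV₀ (N + 1)))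
          (hB N.le_succ).eventuallyLE
      rw [Finset.sum_range_succ, mul_add]
      linarith [hdrift N]
  have hnonneg : 0 ≤ ∫ ω in B N, V N ω ∂μ :=
    integral_nonneg_of_ae (ae_restrict_of_ae (hV₀ N))
  linarith [htelescope N]

end HittingTime

/-! ### A Lyapunov function for step-size level processes -/

/-- A process with step-size level `lev`, step size `a (lev k)`, merit value `u` and stationarity
measure `e`. At each time either the level is raised and everything else is kept, or a step is
taken. On the event `A k`, of conditional probability at least `p`, a step is taken whenever the
level is at least `m`, and it reduces the merit value by a fraction of `a (lev k) * e k`; a step off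
`A k` increases the merit value by at most `err k`, of conditional mean at most
`τ * (a (lev k) * e k)`. -/
structure LevelProcess {S : Type*} {mS : MeasurableSpace S} (μ : Measure S) (𝓕 : Filtration ℕ mS)
    (a : ℕ → ℝ) (m : ℕ) (c p τ : ℝ) (u e err : ℕ → S → ℝ) (lev : ℕ → S → ℕ)
    (A : ℕ → Set S) : Prop where
  antitone : Antitone a
  size_pos : ∀ i, 0 < a i
  rate_pos : 0 < c
  measurable_merit : ∀ k, Measurable[𝓕 k] (u k)
  measurable_stat : ∀ k, Measurable[𝓕 k] (e k)
  measurable_lev : ∀ k, Measurable[𝓕 k] (lev k)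
  measurableSet_good : ∀ k, MeasurableSet (A k)
  integrable_merit : ∀ k, Integrable (u k) μ
  integrable_stat : ∀ k, Integrable (e k) μ
  integrable_err : ∀ k, Integrable (err k) μ
  merit_nonneg : ∀ k ω, 0 ≤ u k ω
  stat_nonneg : ∀ k ω, 0 ≤ e k ω
  err_nonneg : ∀ k ω, 0 ≤ err k ω
  lev_zero_le : ∀ ω, lev 0 ω ≤ m
  le_prob_good : ∀ k, ∀ᵐ ω ∂μ, p ≤ (μ[(A k).indicator fun _ => (1 : ℝ) | 𝓕 k]) ω
  condExp_err_le : ∀ k, ∀ᵐ ω ∂μ, (μ[err k | 𝓕 k]) ω ≤ τ * (a (lev k ω) * e k ω)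
  step : ∀ k ω,
    (lev (k + 1) ω = lev k ω + 1 ∧ u (k + 1) ω = u k ω ∧ e (k + 1) ω = e k ω ∧
      (ω ∈ A k → lev k ω < m)) ∨
    (lev (k + 1) ω = lev k ω - 1 ∧ u (k + 1) ω ≤ u k ω + err k ω ∧
      (ω ∈ A k → u (k + 1) ω ≤ u k ω - c * a (lev k ω) * e k ω))

namespace LevelProcess

section Lyapunov

/-- Weight of the stationarity measure in the Lyapunov function `lyapunov`. -/
noncomputable def weight (v : ℝ) (m i : ℕ) : ℝ := if i ≤ m then v * 4 ^ i else 0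

/-- Lyapunov function of a process at level `i` with merit value `u` and stationarity measure `e`.
Since `e` enters with a negative sign, its unknown value after a step may be dropped, and raising
the level at most `m` decreases the function because the weight quadruples. -/
noncomputable def lyapunov (v ε : ℝ) (m : ℕ) (u e : ℝ) (i : ℕ) : ℝ :=
  u + (-weight v m i * e + ε * v * (i - m : ℕ))

/-- Largest increase of the Lyapunov function at level `i`, apart from the error of a step. -/
noncomputable def increaseBound (v ε : ℝ) (m : ℕ) (e : ℝ) (i : ℕ) : ℝ :=
  2 * weight v m i * e + if i ≤ m then 0 else ε * v

/-- The amount by which the change of the Lyapunov function on the good event stays below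
`increaseBound`. -/
noncomputable def decreaseBound (v ε c : ℝ) (a : ℕ → ℝ) (m : ℕ) (e : ℝ) (i : ℕ) : ℝ :=
  (if i ≤ m then 5 * weight v m i else c * a i) * e + if i ≤ m then 0 else 2 * (ε * v)

variable {v ε c p τ u u' e e' r : ℝ} {a : ℕ → ℝ} {m i : ℕ}

theorem weight_of_le (h : i ≤ m) : weight v m i = v * 4 ^ i := if_pos h

theorem weight_of_lt (h : m < i) : weight v m i = 0 := if_neg h.not_ge

theorem weight_nonneg (hv : 0 ≤ v) (m i : ℕ) : 0 ≤ weight v m i := by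
  unfold weight
  split_ifs <;> positivity

theorem weight_le (hv : 0 ≤ v) (m i : ℕ) : weight v m i ≤ v * 4 ^ m := by
  unfold weight
  split_ifs with hi
  · gcongr
    norm_num
  · positivity

theorem le_weight (hv : 0 ≤ v) (h : i ≤ m) : v ≤ weight v m i :=
  (weight_of_le h).symm ▸ le_mul_of_one_le_right hv (one_le_pow₀ (by norm_num))

theorem decreaseBound_nonneg (hv : 0 ≤ v) (hε : 0 ≤ ε) (hc : 0 ≤ c) (ha : ∀ i, 0 ≤ a i)
    (he : 0 ≤ e) (m i : ℕ) : 0 ≤ decreaseBound v ε c a m e i := by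
  have hweight := weight_nonneg hv m i
  have hai := ha i
  unfold decreaseBound
  split_ifs <;> positivity

theorem lyapunov_succ_le_sub (h : i < m) :
    lyapunov v ε m u e (i + 1) ≤
      lyapunov v ε m u e i + increaseBound v ε m e i - decreaseBound v ε c a m e i := by
  have hexcess : i + 1 - m = 0 := by omega
  have hexcess' : i - m = 0 := by omega
  simp only [lyapunov, increaseBound, decreaseBound, hexcess, hexcess', if_pos h.le,
    weight_of_le h.le, weight_of_le h.nat_succ_le, pow_succ]
  linarith

theorem lyapunov_succ_le (hv : 0 ≤ v) (hε : 0 ≤ ε) (he : ε ≤ e) :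
    lyapunov v ε m u e (i + 1) ≤ lyapunov v ε m u e i + increaseBound v ε m e i := by
  rcases lt_trichotomy i m with hi | rfl | hi
  · refine (lyapunov_succ_le_sub (c := 0) (a := 0) hi).trans (sub_le_self _ ?_)
    exact decreaseBound_nonneg hv hε le_rfl (fun _ => le_rfl) (hε.trans he) m i
  · have hweight : ε * v ≤ weight v i i * e := by
      rw [mul_comm]
      exact mul_le_mul (le_weight hv le_rfl) he hε (weight_nonneg hv i i)
    have hexcess : i + 1 - i = 1 := by omega
    simp only [lyapunov, increaseBound, hexcess, Nat.sub_self, le_refl, if_true,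
      weight_of_lt i.lt_succ_self]
    push_cast
    linarith
  · have hexcess : ((i + 1 - m : ℕ) : ℝ) = (i - m : ℕ) + 1 := by
      rw [← Nat.cast_succ, Nat.succ_sub hi.le]
    simp only [lyapunov, increaseBound, hexcess, if_neg hi.not_ge, weight_of_lt hi,
      weight_of_lt (hi.trans i.lt_succ_self)]
    linarith

theorem lyapunov_pred_le (hv : 0 ≤ v) (hε : 0 ≤ ε) (he : 0 ≤ e) (he' : 0 ≤ e') (h : u' ≤ u + r) :
    lyapunov v ε m u' e' (i - 1) ≤ lyapunov v ε m u e i + increaseBound v ε m e i + r := by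
  have hexcess : ε * v * (i - 1 - m : ℕ) ≤ ε * v * (i - m : ℕ) := by
    gcongr
    omega
  have hdrop := mul_nonneg (weight_nonneg hv m (i - 1)) he'
  have hweight := mul_nonneg (weight_nonneg hv m i) he
  have hjump : 0 ≤ if i ≤ m then 0 else ε * v := by split_ifs <;> positivity
  simp only [lyapunov, increaseBound]
  linarith

theorem lyapunov_pred_le_sub (hv : 0 ≤ v) (hvc : v * 4 ^ (m + 1) ≤ c * a m) (hc : 0 ≤ c)
    (ha : Antitone a) (he : 0 ≤ e) (he' : 0 ≤ e') (h : u' ≤ u - c * a i * e) :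
    lyapunov v ε m u' e' (i - 1) ≤
      lyapunov v ε m u e i + increaseBound v ε m e i - decreaseBound v ε c a m e i := by
  have hdrop := mul_nonneg (weight_nonneg hv m (i - 1)) he'
  rcases le_or_gt i m with hi | hi
  · have hweight : 4 * weight v m i * e ≤ c * a i * e := by
      refine mul_le_mul_of_nonneg_right ?_ he
      calc 4 * weight v m i ≤ 4 * (v * 4 ^ m) := by linarith [weight_le hv m i]
        _ = v * 4 ^ (m + 1) := by ring
        _ ≤ c * a m := hvc
        _ ≤ c * a i := mul_le_mul_of_nonneg_left (ha hi) hc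
    have hexcess : i - m = 0 := by omega
    have hexcess' : i - 1 - m = 0 := by omega
    simp only [lyapunov, increaseBound, decreaseBound, if_pos hi, hexcess, hexcess']
    linarith
  · have hexcess : ((i - m : ℕ) : ℝ) = (i - 1 - m : ℕ) + 1 := by
      rw [← Nat.cast_succ]
      congr 1
      omega
    simp only [lyapunov, increaseBound, decreaseBound, if_neg hi.not_ge, weight_of_lt hi, hexcess]
    linarith

theorem lyapunov_nonneg (hv : 0 ≤ v) (hvc : v * 4 ^ (m + 1) ≤ c * a m) (hε : 0 ≤ ε) (he : 0 ≤ e)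
    (hu : 0 ≤ u) (h : i ≤ m → c * a m * e ≤ u) : 0 ≤ lyapunov v ε m u e i := by
  have hexcess : 0 ≤ ε * v * (i - m : ℕ) := by positivity
  have hweight : weight v m i * e ≤ u := by
    rcases le_or_gt i m with hi | hi
    · refine le_trans (mul_le_mul_of_nonneg_right ?_ he) (h hi)
      calc weight v m i ≤ v * 4 ^ m := weight_le hv m i
        _ ≤ v * 4 ^ (m + 1) := by gcongr <;> norm_num
        _ ≤ c * a m := hvc
    · rwa [weight_of_lt hi, zero_mul]
  unfold lyapunov
  linarith

theorem drift_le (ha : Antitone a) (ha₀ : ∀ i, 0 < a i) (hc : 0 < c) (hp : 3 / 4 ≤ p)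
    (hv : 0 ≤ v) (hvc : v * 4 ^ (m + 1) ≤ c * a m) (hε : 0 ≤ ε) (hτ₀ : 0 ≤ τ)
    (hτ : τ * a 0 ≤ v) (he : ε ≤ e) (i : ℕ) :
    increaseBound v ε m e i - p * decreaseBound v ε c a m e i + τ * (a i * e) ≤ -(v * ε / 2) := by
  have he₀ : 0 ≤ e := hε.trans he
  have hai := ha₀ i
  have hdec := mul_le_mul_of_nonneg_right hp
    (decreaseBound_nonneg hv hε hc.le (fun i => (ha₀ i).le) he₀ m i)
  suffices increaseBound v ε m e i - 3 / 4 * decreaseBound v ε c a m e i + τ * (a i * e)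
      ≤ -(v * ε / 2) by linarith
  rcases le_or_gt i m with hi | hi
  · have hstep : τ * (a i * e) ≤ v * e := by
      calc τ * (a i * e) ≤ τ * (a 0 * e) := by gcongr; exact ha i.zero_le
        _ = τ * a 0 * e := by ring
        _ ≤ v * e := by gcongr
    have hweight : v * e ≤ weight v m i * e := by
      gcongr
      exact le_weight hv hi
    have hεe : v * ε ≤ v * e := by gcongr
    have hve : 0 ≤ v * e := by positivity
    simp only [increaseBound, decreaseBound, if_pos hi]
    linarith
  · have hτc : τ ≤ c / 4 := by
      refine le_of_mul_le_mul_right ?_ (ha₀ 0)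
      have hfour : v * 4 ≤ v * 4 ^ (m + 1) := by
        gcongr
        exact le_self_pow₀ (by norm_num) (by omega)
      have hm : c * a m ≤ c * a 0 := by gcongr; exact ha m.zero_le
      linarith
    have hstep : τ * (a i * e) ≤ c / 4 * (a i * e) := by gcongr
    have hrate : 0 ≤ c * (a i * e) := by positivity
    simp only [increaseBound, decreaseBound, if_neg hi.not_ge, weight_of_lt hi]
    linarith

end Lyapunov

variable {S : Type*} {mS : MeasurableSpace S} {μ : Measure S} {𝓕 : Filtration ℕ mS} {a : ℕ → ℝ}
  {m : ℕ} {c p τ v ε : ℝ} {u e err : ℕ → S → ℝ} {lev : ℕ → S → ℕ} {A : ℕ → Set S}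

theorem lev_le (P : LevelProcess μ 𝓕 a m c p τ u e err lev A) (k : ℕ) (ω : S) :
    lev k ω ≤ m + k := by
  induction k with
  | zero => exact P.lev_zero_le ω
  | succ k ih => rcases P.step k ω with h | h <;> omega

theorem measurable_affine_stat (P : LevelProcess μ 𝓕 a m c p τ u e err lev A) (q r : ℕ → ℝ)
    (k : ℕ) : Measurable[𝓕 k] fun ω => q (lev k ω) * e k ω + r (lev k ω) :=
  ((measurable_from_nat.comp (P.measurable_lev k)).mul (P.measurable_stat k)).add
    (measurable_from_nat.comp (P.measurable_lev k))

theorem integrable_affine_stat [IsFiniteMeasure μ] (P : LevelProcess μ 𝓕 a m c p τ u e err lev A)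
    (q r : ℕ → ℝ) (k : ℕ) : Integrable (fun ω => q (lev k ω) * e k ω + r (lev k ω)) μ := by
  have hmeas (s : ℕ → ℝ) : AEStronglyMeasurable (fun ω => s (lev k ω)) μ :=
    (measurable_from_nat.comp ((P.measurable_lev k).mono (𝓕.le k) le_rfl)).aestronglyMeasurable
  have hbound (s : ℕ → ℝ) (ω : S) : ‖s (lev k ω)‖ ≤ ∑ i ∈ Finset.range (m + k + 1), ‖s i‖ :=
    Finset.single_le_sum (f := fun i => ‖s i‖) (fun _ _ => norm_nonneg _)
      (Finset.mem_range.2 (Nat.lt_succ_of_le (P.lev_le k ω)))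
  exact ((P.integrable_stat k).bdd_mul (hmeas q) (ae_of_all _ (hbound q))).add
    (Integrable.of_bound (hmeas r) _ (ae_of_all _ (hbound r)))

theorem integrable_lyapunov [IsFiniteMeasure μ] (P : LevelProcess μ 𝓕 a m c p τ u e err lev A)
    (v ε : ℝ) (k : ℕ) : Integrable (fun ω => lyapunov v ε m (u k ω) (e k ω) (lev k ω)) μ :=
  (P.integrable_merit k).add
    (P.integrable_affine_stat (fun i => -weight v m i) (fun i => ε * v * (i - m : ℕ)) k)

theorem integrable_increaseBound [IsFiniteMeasure μ]
    (P : LevelProcess μ 𝓕 a m c p τ u e err lev A) (v ε : ℝ) (k : ℕ) :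
    Integrable (fun ω => increaseBound v ε m (e k ω) (lev k ω)) μ :=
  P.integrable_affine_stat (fun i => 2 * weight v m i) (fun i => if i ≤ m then 0 else ε * v) k

theorem measurable_decreaseBound (P : LevelProcess μ 𝓕 a m c p τ u e err lev A) (v ε : ℝ)
    (k : ℕ) : Measurable[𝓕 k] fun ω => decreaseBound v ε c a m (e k ω) (lev k ω) :=
  P.measurable_affine_stat (fun i => if i ≤ m then 5 * weight v m i else c * a i)
    (fun i => if i ≤ m then 0 else 2 * (ε * v)) k

theorem integrable_decreaseBound [IsFiniteMeasure μ]
    (P : LevelProcess μ 𝓕 a m c p τ u e err lev A) (v ε : ℝ) (k : ℕ) :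
    Integrable (fun ω => decreaseBound v ε c a m (e k ω) (lev k ω)) μ :=
  P.integrable_affine_stat (fun i => if i ≤ m then 5 * weight v m i else c * a i)
    (fun i => if i ≤ m then 0 else 2 * (ε * v)) k

theorem integrable_size_mul_stat [IsFiniteMeasure μ]
    (P : LevelProcess μ 𝓕 a m c p τ u e err lev A) (k : ℕ) :
    Integrable (fun ω => a (lev k ω) * e k ω) μ := by
  simpa using P.integrable_affine_stat a 0 k

/- Descending induction on the level: from a level at most `m`, good events lead to a step within
finitely many iterations, and that step reduces the merit value, which stays nonnegative, by at
least `c * a m * e`. -/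
theorem ae_mul_stat_le_merit [IsFiniteMeasure μ] (P : LevelProcess μ 𝓕 a m c p τ u e err lev A)
    (hp : 0 < p) (k : ℕ) : ∀ᵐ ω ∂μ, lev k ω ≤ m → c * a m * e k ω ≤ u k ω := by
  suffices H : ∀ s k, ∀ᵐ ω ∂μ, lev k ω ≤ m → m < lev k ω + s → c * a m * e k ω ≤ u k ω by
    filter_upwards [H (m + 1) k] with ω hω hlev
    exact hω hlev (by omega)
  intro s
  induction s with
  | zero => exact fun k => ae_of_all _ fun ω hlev hlt => absurd hlev (by omega)
  | succ s ih =>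
    intro k
    set B : Set S := {ω | (lev k ω ≤ m ∧ m < lev k ω + (s + 1)) ∧ u k ω < c * a m * e k ω}
    have hB : MeasurableSet[𝓕 k] B :=
      (P.measurable_lev k (MeasurableSet.of_discrete (s := {i | i ≤ m ∧ m < i + (s + 1)}))).inter
        (measurableSet_lt (P.measurable_merit k) ((P.measurable_stat k).const_mul _))
    have hBA : ∀ᵐ ω ∂μ, ω ∉ B ∩ A k := by
      filter_upwards [ih (k + 1)] with ω hω hmem
      obtain ⟨⟨⟨hle, hlt⟩, hviol⟩, hA⟩ := hmem
      rcases P.step k ω with ⟨hlev, hu, he, hgood⟩ | ⟨-, -, hgood⟩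
      · have hlevm := hgood hA
        have hnext := hω (by omega) (by omega)
        rw [hu, he] at hnext
        exact hviol.not_ge hnext
      · have hsize : c * a m * e k ω ≤ c * a (lev k ω) * e k ω :=
          mul_le_mul_of_nonneg_right
            (mul_le_mul_of_nonneg_left (P.antitone hle) P.rate_pos.le) (P.stat_nonneg k ω)
        linarith [hgood hA, P.merit_nonneg (k + 1) ω]
    have hnull : μ B = 0 := measure_eq_zero_of_measure_inter_eq_zero (𝓕.le k) hp
      (P.measurableSet_good k) hB (P.le_prob_good k) (measure_eq_zero_iff_ae_notMem.2 hBA)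
    filter_upwards [measure_eq_zero_iff_ae_notMem.1 hnull] with ω hω hle hlt
    by_contra! hviol
    exact hω ⟨⟨hle, hlt⟩, hviol⟩

theorem ae_lyapunov_nonneg [IsFiniteMeasure μ] (P : LevelProcess μ 𝓕 a m c p τ u e err lev A)
    (hp : 0 < p) (hv : 0 ≤ v) (hvc : v * 4 ^ (m + 1) ≤ c * a m) (hε : 0 ≤ ε) (k : ℕ) :
    ∀ᵐ ω ∂μ, 0 ≤ lyapunov v ε m (u k ω) (e k ω) (lev k ω) :=
  (P.ae_mul_stat_le_merit hp k).mono fun ω hω =>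
    lyapunov_nonneg hv hvc hε (P.stat_nonneg k ω) (P.merit_nonneg k ω) hω

theorem lyapunov_step_le (P : LevelProcess μ 𝓕 a m c p τ u e err lev A) (hv : 0 ≤ v)
    (hvc : v * 4 ^ (m + 1) ≤ c * a m) (hε : 0 ≤ ε) {k : ℕ} {ω : S} (he : ε ≤ e k ω) :
    lyapunov v ε m (u (k + 1) ω) (e (k + 1) ω) (lev (k + 1) ω) ≤
      lyapunov v ε m (u k ω) (e k ω) (lev k ω) + increaseBound v ε m (e k ω) (lev k ω)
      - (A k).indicator (fun ω => decreaseBound v ε c a m (e k ω) (lev k ω)) ω + err k ω := by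
  have herr := P.err_nonneg k ω
  by_cases hA : ω ∈ A k
  · rw [Set.indicator_of_mem hA]
    refine le_add_of_le_of_nonneg ?_ herr
    rcases P.step k ω with ⟨hlev, hu, he', hgood⟩ | ⟨hlev, -, hgood⟩
    · rw [hlev, hu, he']
      exact lyapunov_succ_le_sub (hgood hA)
    · rw [hlev]
      exact lyapunov_pred_le_sub hv hvc P.rate_pos.le P.antitone (P.stat_nonneg _ _)
        (P.stat_nonneg _ _) (hgood hA)
  · rw [Set.indicator_of_notMem hA, sub_zero]
    rcases P.step k ω with ⟨hlev, hu, he', -⟩ | ⟨hlev, hbad, -⟩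
    · rw [hlev, hu, he']
      exact le_add_of_le_of_nonneg (lyapunov_succ_le hv hε he) herr
    · rw [hlev]
      exact lyapunov_pred_le hv hε (P.stat_nonneg _ _) (P.stat_nonneg _ _) hbad

theorem setIntegral_lyapunov_succ_le_add [IsFiniteMeasure μ]
    (P : LevelProcess μ 𝓕 a m c p τ u e err lev A) (hv : 0 ≤ v)
    (hvc : v * 4 ^ (m + 1) ≤ c * a m) (hε : 0 ≤ ε) {k : ℕ} {B : Set S}
    (hB : MeasurableSet B) (he : ∀ ω ∈ B, ε ≤ e k ω) :
    ∫ ω in B, lyapunov v ε m (u (k + 1) ω) (e (k + 1) ω) (lev (k + 1) ω) ∂μ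
      ≤ ∫ ω in B, lyapunov v ε m (u k ω) (e k ω) (lev k ω) ∂μ
        + ∫ ω in B, increaseBound v ε m (e k ω) (lev k ω) ∂μ
        - ∫ ω in B, (A k).indicator (fun ω => decreaseBound v ε c a m (e k ω) (lev k ω)) ω ∂μ
        + ∫ ω in B, err k ω ∂μ := by
  have hV (k : ℕ) := P.integrable_lyapunov v ε k
  have hinc := P.integrable_increaseBound v ε k
  have hdec := (P.integrable_decreaseBound v ε k).indicator (P.measurableSet_good k)
  have herr := P.integrable_err k
  rw [← integral_add (hV k).integrableOn hinc.integrableOn,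
    ← integral_sub (by exact ((hV k).add hinc).integrableOn) hdec.integrableOn,
    ← integral_add (by exact (((hV k).add hinc).sub hdec).integrableOn) herr.integrableOn]
  exact setIntegral_mono_on (hV (k + 1)).integrableOn
    ((((hV k).add hinc).sub hdec).add herr).integrableOn hB
    fun ω hω => P.lyapunov_step_le hv hvc hε (he ω hω)

theorem setIntegral_drift_le [IsFiniteMeasure μ] (P : LevelProcess μ 𝓕 a m c p τ u e err lev A)
    (hp : 3 / 4 ≤ p) (hv : 0 ≤ v) (hvc : v * 4 ^ (m + 1) ≤ c * a m) (hε : 0 ≤ ε) (hτ₀ : 0 ≤ τ)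
    (hτ : τ * a 0 ≤ v) {k : ℕ} {B : Set S} (hB : MeasurableSet B) (he : ∀ ω ∈ B, ε ≤ e k ω) :
    ∫ ω in B, increaseBound v ε m (e k ω) (lev k ω) ∂μ
      - ∫ ω in B, p * decreaseBound v ε c a m (e k ω) (lev k ω) ∂μ
      + ∫ ω in B, τ * (a (lev k ω) * e k ω) ∂μ ≤ -(v * ε / 2) * μ.real B := by
  have hinc := P.integrable_increaseBound v ε k
  have hdec := (P.integrable_decreaseBound v ε k).const_mul p
  have hsize := (P.integrable_size_mul_stat k).const_mul τ
  rw [← integral_sub hinc.integrableOn hdec.integrableOn,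
    ← integral_add (by exact (hinc.sub hdec).integrableOn) hsize.integrableOn, mul_comm,
    ← smul_eq_mul, ← setIntegral_const]
  exact setIntegral_mono_on ((hinc.sub hdec).add hsize).integrableOn (integrable_const _) hB
    fun ω hω => drift_le P.antitone P.size_pos P.rate_pos hp hv hvc hε hτ₀ hτ (he ω hω) _

theorem setIntegral_lyapunov_succ_le [IsFiniteMeasure μ]
    (P : LevelProcess μ 𝓕 a m c p τ u e err lev A) (hp : 3 / 4 ≤ p) (hv : 0 ≤ v)
    (hvc : v * 4 ^ (m + 1) ≤ c * a m) (hε : 0 ≤ ε) (hτ₀ : 0 ≤ τ) (hτ : τ * a 0 ≤ v) {k : ℕ}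
    {B : Set S} (hB : MeasurableSet[𝓕 k] B) (he : ∀ ω ∈ B, ε ≤ e k ω) :
    ∫ ω in B, lyapunov v ε m (u (k + 1) ω) (e (k + 1) ω) (lev (k + 1) ω) ∂μ
      ≤ ∫ ω in B, lyapunov v ε m (u k ω) (e k ω) (lev k ω) ∂μ - v * ε / 2 * μ.real B := by
  have hdec := P.integrable_decreaseBound v ε k
  have hgood : ∫ ω in B, p * decreaseBound v ε c a m (e k ω) (lev k ω) ∂μ
      ≤ ∫ ω in B, (A k).indicator (fun ω => decreaseBound v ε c a m (e k ω) (lev k ω)) ω ∂μ :=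
    setIntegral_le_of_le_condExp (𝓕.le k) (hdec.indicator (P.measurableSet_good k))
      (hdec.const_mul p)
      (mul_le_condExp_indicator (P.measurableSet_good k) (P.le_prob_good k)
        (P.measurable_decreaseBound v ε k) hdec fun ω => decreaseBound_nonneg hv hε P.rate_pos.le
          (fun i => (P.size_pos i).le) (P.stat_nonneg k ω) m _) hB
  have herr : ∫ ω in B, err k ω ∂μ ≤ ∫ ω in B, τ * (a (lev k ω) * e k ω) ∂μ :=
    setIntegral_le_of_condExp_le (𝓕.le k) (P.integrable_err k)
      ((P.integrable_size_mul_stat k).const_mul τ) (P.condExp_err_le k) hB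
  have hstep := P.setIntegral_lyapunov_succ_le_add hv hvc hε (𝓕.le k B hB) he
  have hdrift := P.setIntegral_drift_le hp hv hvc hε hτ₀ hτ (𝓕.le k B hB) he
  linarith

theorem lintegral_hit_le [IsFiniteMeasure μ] (P : LevelProcess μ 𝓕 a m c p τ u e err lev A)
    (hp : 3 / 4 ≤ p) (hv : 0 < v) (hvc : v * 4 ^ (m + 1) ≤ c * a m) (hε : 0 < ε) (hτ₀ : 0 ≤ τ)
    (hτ : τ * a 0 ≤ v) :
    ∫⁻ ω, ⨅ (k : ℕ) (_ : e k ω < ε), (k : ENNReal) ∂μ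
      ≤ ENNReal.ofReal (2 * (∫ ω, u 0 ω ∂μ) / (v * ε)) := by
  have hmeas (k : ℕ) : MeasurableSet[𝓕 k] (notYet e ε k) :=
    measurableSet_notYet P.measurable_stat ε k
  refine lintegral_iInf_le_of_sum_notYet_le (fun k => 𝓕.le k _ (hmeas k)) fun N => ?_
  have hsum := mul_sum_measureReal_le_of_drift (antitone_notYet e ε)
    (P.integrable_lyapunov v ε) (P.ae_lyapunov_nonneg (by linarith) hv.le hvc hε.le)
    (fun k => P.setIntegral_lyapunov_succ_le hp hv.le hvc hε.le hτ₀ hτ (hmeas k)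
      fun ω hω => hω k le_rfl) N
  have hinit : ∫ ω, lyapunov v ε m (u 0 ω) (e 0 ω) (lev 0 ω) ∂μ ≤ ∫ ω, u 0 ω ∂μ := by
    refine integral_mono (P.integrable_lyapunov v ε 0) (P.integrable_merit 0) fun ω => ?_
    have hweight := mul_nonneg (weight_nonneg hv.le m (lev 0 ω)) (P.stat_nonneg 0 ω)
    simp only [lyapunov, Nat.sub_eq_zero_of_le (P.lev_zero_le ω)]
    push_cast
    linarith
  rw [le_div_iff₀ (by positivity)]
  linarith

end LevelProcess

/-! ### Measurability of the iteration -/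

namespace Run

variable {n m₁ m₂ : ℕ} {Q : Problem n m₁ m₂} {A : Params} {x₀ : E n} {ρ₀ p₀ : ℝ} {S : Type*}

section Definitions

variable [MeasurableSpace S] (R : Run Q A x₀ ρ₀ p₀ S)

/-- The reduction `Δ_k(ρ₀)` predicted by the model for the initial penalty parameter. -/
noncomputable def reduction (k : ℕ) (ω : S) : ℝ :=
  -inner ℝ (R.g k ω) (R.d k ω) + ρ₀ * Q.deltaPhi (R.x k ω) (A.sigma Q (R.x k ω))

/-- The event that the initial penalty parameter passes the line search test at iteration `k`. -/
def successEvent (k : ℕ) : Set S :=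
  {ω | A.θ * R.α k ω * R.reduction k ω ≤
      (R.f0 k ω + ρ₀ * Q.phi (R.x k ω))
        - (R.fs k ω + ρ₀ * Q.phi (R.x k ω + R.α k ω • R.d k ω))}

open scoped Classical in
/-- The level `i` of the step size `α_max / γ ^ i` at iteration `k`, as long as the penalty
parameter keeps its initial value. Truncated subtraction encodes the cap `α_max`. -/
noncomputable def level : ℕ → S → ℕ
  | 0, _ => A.j₀
  | k + 1, ω => if ω ∈ R.successEvent k then level k ω - 1 else level k ω + 1

/-- The initial penalty parameter satisfies the update test at every iteration, so that it is never
increased. -/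
def SufficientReduction : Prop :=
  ∀ k ω, 1 / 2 * quad (R.H k ω) (R.d k ω) ≤ R.reduction k ω

/-- The error of the function estimates where they are not `ε_f`-sufficiently accurate. -/
noncomputable def estimateError (εf : ℝ) (k : ℕ) : S → ℝ :=
  (R.funEvent εf k)ᶜ.indicator (fun ω => |R.f0 k ω - Q.f (R.x k ω)|) +
    (R.funEvent εf k)ᶜ.indicator fun ω => |R.fs k ω - Q.f (R.x k ω + R.α k ω • R.d k ω)|

theorem estimateError_nonneg (εf : ℝ) (k : ℕ) (ω : S) : 0 ≤ R.estimateError εf k ω :=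
  add_nonneg (Set.indicator_nonneg (fun _ _ => abs_nonneg _) ω)
    (Set.indicator_nonneg (fun _ _ => abs_nonneg _) ω)

/- A larger estimate would raise the threshold above `A.ζ₀`. -/
theorem norm_g_le (hζ : ∀ k ω, R.ζ k ω = A.ζ₀) (k : ℕ) (ω : S) : ‖R.g k ω‖ ≤ A.ζ₀ := by
  by_contra! hlarge
  have hraise := (R.ζ_large k ω (by rwa [hζ])).1
  rw [hζ, hζ] at hraise
  linarith [le_max_left (A.ζ₀ + A.ζc) ‖R.g k ω‖, A.ζc_pos]

theorem isQPSolution (k : ℕ) (ω : S) :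
    Q.IsQPSolution (R.x k ω) (Q.kap (R.x k ω) (A.sigma Q (R.x k ω))) (R.β k ω) (R.g k ω)
      (R.H k ω) (R.d k ω) :=
  ⟨R.d_mem k ω, R.d_min k ω⟩

theorem linPhi_d_le (k : ℕ) (ω : S) :
    Q.linPhi (R.x k ω) (R.d k ω) ≤ Q.kap (R.x k ω) (A.sigma Q (R.x k ω)) :=
  ((Problem.mem_qpFeasible_iff _ _ (Problem.kap_nonneg _ _)).1 (R.d_mem k ω)).1

end Definitions

namespace SufficientReduction

variable [MeasurableSpace S] {R : Run Q A x₀ ρ₀ p₀ S}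

theorem rho_eq (hR : R.SufficientReduction) (k : ℕ) (ω : S) : R.ρ k ω = ρ₀ := by
  induction k with
  | zero => exact R.ρ_zero ω
  | succ k ih => rw [R.ρ_keep k ω (by rw [ih]; exact hR k ω), ih]

theorem step_of_mem (hR : R.SufficientReduction) {k : ℕ} {ω : S} (h : ω ∈ R.successEvent k) :
    R.x (k + 1) ω = R.x k ω + R.α k ω • R.d k ω ∧ R.α (k + 1) ω = min (A.γ * R.α k ω) A.αmax :=
  R.step_success k ω (by rw [hR.rho_eq (k + 1) ω]; exact h)

theorem step_of_notMem (hR : R.SufficientReduction) {k : ℕ} {ω : S} (h : ω ∉ R.successEvent k) :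
    R.x (k + 1) ω = R.x k ω ∧ R.α (k + 1) ω = A.γ⁻¹ * R.α k ω :=
  R.step_fail k ω (by rw [hR.rho_eq (k + 1) ω]; exact h)

theorem alpha_eq (hR : R.SufficientReduction) (k : ℕ) (ω : S) :
    R.α k ω = A.αmax / A.γ ^ R.level k ω := by
  have hγ₀ : A.γ ≠ 0 := (one_pos.trans A.γ_gt).ne'
  induction k with
  | zero => exact R.α_zero ω
  | succ k ih =>
    by_cases h : ω ∈ R.successEvent k
    · rw [(hR.step_of_mem h).2, level, if_pos h, ih]
      cases R.level k ω with
      | zero =>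
        rw [pow_zero, div_one]
        exact min_eq_right (le_mul_of_one_le_left A.αmax_pos.le A.γ_gt.le)
      | succ i =>
        have hraise : A.γ * (A.αmax / A.γ ^ (i + 1)) = A.αmax / A.γ ^ i := by
          rw [pow_succ]
          field_simp
        rw [hraise, Nat.add_sub_cancel]
        exact min_eq_left (div_le_self A.αmax_pos.le (one_le_pow₀ A.γ_gt.le))
    · rw [(hR.step_of_notMem h).2, level, if_neg h, ih, pow_succ]
      field_simp

theorem alpha_pos (hR : R.SufficientReduction) (k : ℕ) (ω : S) : 0 < R.α k ω := by
  rw [hR.alpha_eq]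
  exact div_pos A.αmax_pos (pow_pos (one_pos.trans A.γ_gt) _)

theorem alpha_le (hR : R.SufficientReduction) (k : ℕ) (ω : S) : R.α k ω ≤ A.αmax := by
  rw [hR.alpha_eq]
  exact div_le_self A.αmax_pos.le (one_le_pow₀ A.γ_gt.le)

end SufficientReduction

section Filtration

variable [mS : MeasurableSpace S] (R : Run Q A x₀ ρ₀ p₀ S)

theorem past_le_pastHalf (k : ℕ) : R.past k ≤ R.pastHalf k := le_sup_left

theorem past_mono : Monotone R.past := fun _ _ hkl =>
  iSup_le fun i => le_iSup_of_le (Fin.castLE hkl i) le_rfl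

theorem comap_le_past_succ (k : ℕ) : MeasurableSpace.comap (R.g k) inferInstance ⊔
    MeasurableSpace.comap (R.f0 k) inferInstance ⊔ MeasurableSpace.comap (R.fs k) inferInstance
    ≤ R.past (k + 1) :=
  le_iSup_of_le (Fin.last k) le_rfl

theorem pastHalf_le_past_succ (k : ℕ) : R.pastHalf k ≤ R.past (k + 1) :=
  sup_le (R.past_mono k.le_succ) ((le_sup_left.trans le_sup_left).trans (R.comap_le_past_succ k))

theorem past_le (k : ℕ) : R.past k ≤ mS :=
  iSup_le fun i => sup_le (sup_le (R.meas_g i).comap_le (R.meas_f0 i).comap_le)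
    (R.meas_fs i).comap_le

theorem pastHalf_le (k : ℕ) : R.pastHalf k ≤ mS :=
  (R.pastHalf_le_past_succ k).trans (R.past_le _)

theorem measurable_g_pastHalf (k : ℕ) : Measurable[R.pastHalf k] (R.g k) :=
  measurable_iff_comap_le.2 le_sup_right

theorem measurable_f0_past (k : ℕ) : Measurable[R.past (k + 1)] (R.f0 k) :=
  measurable_iff_comap_le.2 ((le_sup_right.trans le_sup_left).trans (R.comap_le_past_succ k))

theorem measurable_fs_past (k : ℕ) : Measurable[R.past (k + 1)] (R.fs k) :=
  measurable_iff_comap_le.2 (le_sup_right.trans (R.comap_le_past_succ k))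

/-- The filtration of the histories `𝓕_{k-1}`. -/
def pastFiltration : Filtration ℕ mS where
  seq := R.past
  mono' := R.past_mono
  le' := R.past_le

end Filtration

namespace SufficientReduction

theorem measurable_alpha_of_level {F : MeasurableSpace S} [mS : MeasurableSpace S]
    {R : Run Q A x₀ ρ₀ p₀ S} (hR : R.SufficientReduction) {k : ℕ}
    (h : Measurable[F] (R.level k)) : Measurable[F] (R.α k) := by
  rw [show R.α k = (fun i : ℕ => A.αmax / A.γ ^ i) ∘ R.level k from funext (hR.alpha_eq k)]
  exact measurable_from_nat.comp h

variable [mS : MeasurableSpace S] {R : Run Q A x₀ ρ₀ p₀ S}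

theorem measurableSet_successEvent (hR : R.SufficientReduction) (hQ : Q.IsC1) (hA : R.Adapted)
    {k : ℕ} (hx : Measurable[R.past k] (R.x k)) (hlev : Measurable[R.past k] (R.level k)) :
    MeasurableSet[R.past (k + 1)] (R.successEvent k) := by
  have hx' : Measurable[R.past (k + 1)] (R.x k) := hx.mono (R.past_mono k.le_succ) le_rfl
  have hα : Measurable[R.past (k + 1)] (R.α k) :=
    hR.measurable_alpha_of_level (hlev.mono (R.past_mono k.le_succ) le_rfl)
  have hd : Measurable[R.past (k + 1)] (R.d k) := (hA k).mono (R.pastHalf_le_past_succ k) le_rfl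
  have hg : Measurable[R.past (k + 1)] (R.g k) :=
    (R.measurable_g_pastHalf k).mono (R.pastHalf_le_past_succ k) le_rfl
  have hφ : Measurable Q.phi := hQ.continuous_phi.measurable
  have hreduction : Measurable[R.past (k + 1)] (R.reduction k) :=
    (hg.inner hd).neg.add (((hφ.sub (hQ.measurable_kap A)).comp hx').const_mul ρ₀)
  exact measurableSet_le ((hα.const_mul A.θ).mul hreduction)
    (((R.measurable_f0_past k).add ((hφ.comp hx').const_mul ρ₀)).sub
      ((R.measurable_fs_past k).add ((hφ.comp (hx'.add (hα.smul hd))).const_mul ρ₀)))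

theorem measurable_x_and_level (hR : R.SufficientReduction) (hQ : Q.IsC1) (hA : R.Adapted)
    (k : ℕ) : Measurable[R.past k] (R.x k) ∧ Measurable[R.past k] (R.level k) := by
  classical
  induction k with
  | zero => exact ⟨(funext R.x_zero : R.x 0 = fun _ => x₀) ▸ measurable_const, measurable_const⟩
  | succ k ih =>
    obtain ⟨hx, hlev⟩ := ih
    have hsuccess := hR.measurableSet_successEvent hQ hA hx hlev
    have hx' : Measurable[R.past (k + 1)] (R.x k) := hx.mono (R.past_mono k.le_succ) le_rfl
    have hlev' : Measurable[R.past (k + 1)] (R.level k) :=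
      hlev.mono (R.past_mono k.le_succ) le_rfl
    have hd : Measurable[R.past (k + 1)] (R.d k) :=
      (hA k).mono (R.pastHalf_le_past_succ k) le_rfl
    constructor
    · have hsucc : R.x (k + 1) = fun ω => if ω ∈ R.successEvent k then
          R.x k ω + R.α k ω • R.d k ω else R.x k ω := by
        ext1 ω
        split_ifs with h
        exacts [(hR.step_of_mem h).1, (hR.step_of_notMem h).1]
      rw [hsucc]
      exact Measurable.ite hsuccess
        (hx'.add ((hR.measurable_alpha_of_level hlev').smul hd)) hx'
    · have hsucc : R.level (k + 1) = fun ω => if ω ∈ R.successEvent k then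
          R.level k ω - 1 else R.level k ω + 1 := by
        ext1 ω
        rw [level]
      rw [hsucc]
      exact Measurable.ite hsuccess ((measurable_from_nat (f := fun i : ℕ => i - 1)).comp hlev')
        ((measurable_from_nat (f := fun i : ℕ => i + 1)).comp hlev')

theorem measurable_x (hR : R.SufficientReduction) (hQ : Q.IsC1) (hA : R.Adapted) (k : ℕ) :
    Measurable[R.past k] (R.x k) := (hR.measurable_x_and_level hQ hA k).1

theorem measurable_level (hR : R.SufficientReduction) (hQ : Q.IsC1) (hA : R.Adapted) (k : ℕ) :
    Measurable[R.past k] (R.level k) := (hR.measurable_x_and_level hQ hA k).2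

theorem measurable_alpha (hR : R.SufficientReduction) (hQ : Q.IsC1) (hA : R.Adapted) (k : ℕ) :
    Measurable[R.past k] (R.α k) :=
  hR.measurable_alpha_of_level (hR.measurable_level hQ hA k)

theorem measurable_stationarity (hR : R.SufficientReduction) (hQ : Q.IsC1) (hA : R.Adapted)
    (k : ℕ) : Measurable[R.past k] fun ω => Q.phi (R.x k ω) ^ 2 + Q.chi A.βl (R.x k ω) ^ 2 :=
  ((hQ.continuous_phi.measurable.pow_const 2).add
    ((hQ.measurable_chi (by linarith [A.βl_gt, A.σu_pos])).pow_const 2)).comp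
    (hR.measurable_x hQ hA k)

theorem measurableSet_gradEvent (hR : R.SufficientReduction) (hQ : Q.IsC1) (hA : R.Adapted)
    (κg : ℝ) (k : ℕ) : MeasurableSet[R.pastHalf k] (R.gradEvent κg k) := by
  have hx := (hR.measurable_x hQ hA k).mono (R.past_le_pastHalf k) le_rfl
  have hα := (hR.measurable_alpha hQ hA k).mono (R.past_le_pastHalf k) le_rfl
  have hgrad : Measurable (gradient Q.f) := (continuous_gradient hQ.f).measurable
  exact measurableSet_le (measurable_norm.comp ((R.measurable_g_pastHalf k).sub (hgrad.comp hx)))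
    ((hα.const_mul κg).mul (measurable_norm.comp (hA k)))

theorem measurableSet_funEvent (hR : R.SufficientReduction) (hQ : Q.IsC1) (hA : R.Adapted)
    (εf : ℝ) (k : ℕ) : MeasurableSet (R.funEvent εf k) := by
  have hx := (hR.measurable_x hQ hA k).mono (R.past_le k) le_rfl
  have hα := (hR.measurable_alpha hQ hA k).mono (R.past_le k) le_rfl
  have hd := (hA k).mono (R.pastHalf_le k) le_rfl
  have hf : Measurable Q.f := hQ.f.continuous.measurable
  have hbound : Measurable fun ω => εf * R.α k ω ^ 2 * ‖R.d k ω‖ ^ 2 :=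
    ((hα.pow_const 2).const_mul εf).mul (hd.norm.pow_const 2)
  exact (measurableSet_le ((R.meas_f0 k).sub (hf.comp hx)).norm hbound).inter
    (measurableSet_le ((R.meas_fs k).sub (hf.comp (hx.add (hα.smul hd)))).norm hbound)

end SufficientReduction

end Run

/-! ### Decrease of the penalty function -/

namespace Run

variable {n m₁ m₂ : ℕ} {Q : Problem n m₁ m₂} {A : Params} {x₀ : E n} {ρ₀ p₀ : ℝ} {S : Type*}
  {Ω K : Set (E n)} {Lf : NNReal} {Lh : Fin m₁ → NNReal} {Lc : Fin m₂ → NNReal}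
  {ξ MH κg εf : ℝ}

section Descent

variable [MeasurableSpace S] {R : Run Q A x₀ ρ₀ p₀ S} {k : ℕ} {ω : S}

theorem inner_gradient_le_of_mem_gradEvent (hI : ω ∈ R.gradEvent κg k) :
    inner ℝ (gradient Q.f (R.x k ω)) (R.d k ω) ≤
      inner ℝ (R.g k ω) (R.d k ω) + κg * R.α k ω * ‖R.d k ω‖ ^ 2 := by
  have hCS := (abs_le.1 (abs_real_inner_le_norm (R.g k ω - gradient Q.f (R.x k ω)) (R.d k ω))).1
  rw [inner_sub_left] at hCS
  have herror : ‖R.g k ω - gradient Q.f (R.x k ω)‖ * ‖R.d k ω‖ ≤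
      κg * R.α k ω * ‖R.d k ω‖ * ‖R.d k ω‖ := mul_le_mul_of_nonneg_right hI (norm_nonneg _)
  linarith

namespace SufficientReduction

theorem mul_norm_sq_le_reduction (hR : R.SufficientReduction) (hH : R.HessianBounds ξ MH)
    (k : ℕ) (ω : S) :
    ξ * ‖R.d k ω‖ ^ 2 ≤ R.reduction k ω := by
  linarith [hR k ω, (hH k ω (R.d k ω)).1]

theorem mem_successEvent (hR : R.SufficientReduction) (hΩ : Q.RegularOn Ω Lf Lh Lc)
    (hst : R.StaysIn K Ω) (hH : R.HessianBounds ξ MH) (hρ : 0 ≤ ρ₀) (hI : ω ∈ R.gradEvent κg k)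
    (hJ : ω ∈ R.funEvent εf k) (hα₁ : R.α k ω ≤ 1)
    (hα : R.α k ω * (κg + Lf + 2 * εf + ρ₀ * Lhc Lh Lc) ≤ (1 - A.θ) * ξ) :
    ω ∈ R.successEvent k := by
  have hα₀ := hR.alpha_pos k ω
  have hΨ := hΩ.Psi_add_smul_le hρ hα₀.le hα₁ (hst.2 k ω) (R.linPhi_d_le k ω)
  rw [Problem.Psi, Problem.Psi] at hΨ
  have hgrad := mul_le_mul_of_nonneg_left (inner_gradient_le_of_mem_gradEvent hI) hα₀.le
  have hcurvature : R.α k ω * (R.α k ω * (κg + Lf + 2 * εf + ρ₀ * Lhc Lh Lc) * ‖R.d k ω‖ ^ 2)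
      ≤ R.α k ω * ((1 - A.θ) * R.reduction k ω) := by
    refine mul_le_mul_of_nonneg_left ?_ hα₀.le
    calc _ ≤ (1 - A.θ) * ξ * ‖R.d k ω‖ ^ 2 := mul_le_mul_of_nonneg_right hα (sq_nonneg _)
      _ = (1 - A.θ) * (ξ * ‖R.d k ω‖ ^ 2) := mul_assoc _ _ _
      _ ≤ _ := mul_le_mul_of_nonneg_left (hR.mul_norm_sq_le_reduction hH k ω)
          (sub_nonneg.2 A.θ_lt.le)
  change A.θ * R.α k ω * R.reduction k ω ≤ _
  unfold reduction at hcurvature ⊢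
  linarith [(abs_le.1 hJ.1).1, (abs_le.1 hJ.2).2]

theorem Psi_succ_le_add_abs (hR : R.SufficientReduction) (hH : R.HessianBounds ξ MH)
    (hs : ω ∈ R.successEvent k) :
    Q.Psi ρ₀ (R.x (k + 1) ω) ≤ Q.Psi ρ₀ (R.x k ω) - A.θ * R.α k ω * (ξ * ‖R.d k ω‖ ^ 2) +
      (|R.f0 k ω - Q.f (R.x k ω)| + |R.fs k ω - Q.f (R.x k ω + R.α k ω • R.d k ω)|) := by
  have htest : A.θ * R.α k ω * R.reduction k ω ≤ (R.f0 k ω + ρ₀ * Q.phi (R.x k ω))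
      - (R.fs k ω + ρ₀ * Q.phi (R.x k ω + R.α k ω • R.d k ω)) := hs
  have hreduction := mul_le_mul_of_nonneg_left (hR.mul_norm_sq_le_reduction hH k ω)
    (mul_nonneg A.θ_pos.le (hR.alpha_pos k ω).le)
  rw [(hR.step_of_mem hs).1, Problem.Psi, Problem.Psi]
  linarith [le_abs_self (R.f0 k ω - Q.f (R.x k ω)),
    neg_le_abs (R.fs k ω - Q.f (R.x k ω + R.α k ω • R.d k ω))]

theorem Psi_succ_le_of_mem_funEvent (hR : R.SufficientReduction) (hH : R.HessianBounds ξ MH)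
    (hεf : 4 * A.αmax * εf ≤ ξ * A.θ) (hs : ω ∈ R.successEvent k) (hJ : ω ∈ R.funEvent εf k)
    (hε₀ : 0 ≤ εf) :
    Q.Psi ρ₀ (R.x (k + 1) ω) ≤
      Q.Psi ρ₀ (R.x k ω) - A.θ * ξ / 2 * (R.α k ω * ‖R.d k ω‖ ^ 2) := by
  have hα₀ := hR.alpha_pos k ω
  have herror : R.α k ω * εf ≤ ξ * A.θ / 4 := by
    linarith [mul_le_mul_of_nonneg_right (hR.alpha_le k ω) hε₀]
  have herror' := mul_le_mul_of_nonneg_right herror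
    (mul_nonneg hα₀.le (sq_nonneg ‖R.d k ω‖))
  linarith [hR.Psi_succ_le_add_abs hH hs, hJ.1, hJ.2]

theorem Psi_succ_le_add_estimateError (hR : R.SufficientReduction) (hH : R.HessianBounds ξ MH)
    (hξ : 0 ≤ ξ) (hε₀ : 0 ≤ εf) (hεf : 4 * A.αmax * εf ≤ ξ * A.θ) (hs : ω ∈ R.successEvent k) :
    Q.Psi ρ₀ (R.x (k + 1) ω) ≤ Q.Psi ρ₀ (R.x k ω) + R.estimateError εf k ω := by
  have hα₀ := (hR.alpha_pos k ω).le
  have hθ := A.θ_pos.le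
  by_cases hJ : ω ∈ R.funEvent εf k
  · have hdecrease : 0 ≤ A.θ * ξ / 2 * (R.α k ω * ‖R.d k ω‖ ^ 2) := by positivity
    linarith [hR.Psi_succ_le_of_mem_funEvent hH hεf hs hJ hε₀, R.estimateError_nonneg εf k ω]
  · have hdecrease : 0 ≤ A.θ * R.α k ω * (ξ * ‖R.d k ω‖ ^ 2) := by positivity
    have hJc : ω ∈ (R.funEvent εf k)ᶜ := hJ
    rw [estimateError, Pi.add_apply, Set.indicator_of_mem hJc, Set.indicator_of_mem hJc]
    linarith [hR.Psi_succ_le_add_abs hH hs]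

theorem Psi_succ_le_sub (hR : R.SufficientReduction) (hH : R.HessianBounds ξ MH)
    (hξ : 0 ≤ ξ) (hε₀ : 0 ≤ εf) (hεf : 4 * A.αmax * εf ≤ ξ * A.θ) (hs : ω ∈ R.successEvent k)
    (hJ : ω ∈ R.funEvent εf k) {C e : ℝ} (hC : 0 < C) (he : e ≤ C * ‖R.d k ω‖ ^ 2) :
    Q.Psi ρ₀ (R.x (k + 1) ω) ≤ Q.Psi ρ₀ (R.x k ω) - A.θ * ξ / (2 * C) * R.α k ω * e := by
  have hα₀ := (hR.alpha_pos k ω).le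
  have hθ := A.θ_pos.le
  have hdecrease : A.θ * ξ / (2 * C) * R.α k ω * e ≤
      A.θ * ξ / 2 * (R.α k ω * ‖R.d k ω‖ ^ 2) := by
    calc _ ≤ A.θ * ξ / (2 * C) * R.α k ω * (C * ‖R.d k ω‖ ^ 2) := by gcongr
      _ = _ := by field_simp
  linarith [hR.Psi_succ_le_of_mem_funEvent hH hεf hs hJ hε₀]

theorem level_lt_of_notMem_successEvent (hR : R.SufficientReduction)
    (hΩ : Q.RegularOn Ω Lf Lh Lc) (hst : R.StaysIn K Ω) (hH : R.HessianBounds ξ MH) (hρ : 0 ≤ ρ₀)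
    (hκg : 0 ≤ κg) (hε₀ : 0 ≤ εf) {m : ℕ} (hm₁ : A.αmax / A.γ ^ m ≤ 1)
    (hm : A.αmax / A.γ ^ m * (κg + Lf + 2 * εf + ρ₀ * Lhc Lh Lc) ≤ (1 - A.θ) * ξ)
    (hs : ω ∉ R.successEvent k) (hgood : ω ∈ R.gradEvent κg k ∩ R.funEvent εf k) :
    R.level k ω < m := by
  by_contra! hlev
  have hα : R.α k ω ≤ A.αmax / A.γ ^ m := by
    rw [hR.alpha_eq]
    exact div_le_div_of_nonneg_left A.αmax_pos.le (pow_pos (one_pos.trans A.γ_gt) _)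
      (pow_le_pow_right₀ A.γ_gt.le hlev)
  have hL : 0 ≤ Lhc Lh Lc := NNReal.coe_nonneg _
  exact hs (hR.mem_successEvent hΩ hst hH hρ hgood.1 hgood.2 (hα.trans hm₁)
    ((mul_le_mul_of_nonneg_right hα (by positivity)).trans hm))

end SufficientReduction

end Descent

section LevelProcess

/-- The assumptions on the process in the bounded regime: it stays in `K` and `Ω`, the Hessian
models are uniformly elliptic, the threshold and the accuracy probability `pg` are never updated,
and the estimates are accurate in the sense of the constants `κg`, `εf`, `κf` and `pf`. -/
structure StandingAssumptions [MeasurableSpace S] (R : Run Q A x₀ ρ₀ p₀ S) (μ : Measure S)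
    (K Ω : Set (E n)) (ξ MH κg εf κf pf pg : ℝ) : Prop where
  adapted : R.Adapted
  staysIn : R.StaysIn K Ω
  hessianBounds : R.HessianBounds ξ MH
  threshold_eq : ∀ k ω, R.ζ k ω = A.ζ₀
  pg_eq : ∀ k ω, R.pg k ω = pg
  gradAccurate : R.GradAccurate μ κg
  funAccurate : R.FunAccurate μ εf pf
  varianceCond : R.VarianceCond μ κf

variable [mS : MeasurableSpace S] {R : Run Q A x₀ ρ₀ p₀ S} {μ : Measure S}

namespace SufficientReduction

theorem measurable_Psi (hR : R.SufficientReduction) (hQ : Q.IsC1) (hA : R.Adapted) (k : ℕ) :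
    Measurable[R.past k] fun ω => Q.Psi ρ₀ (R.x k ω) :=
  (hQ.continuous_Psi ρ₀).measurable.comp (hR.measurable_x hQ hA k)

theorem integrable_Psi [IsFiniteMeasure μ] (hR : R.SufficientReduction) (hQ : Q.IsC1)
    (hA : R.Adapted) (hK : IsCompact K) (hst : R.StaysIn K Ω) (k : ℕ) :
    Integrable (fun ω => Q.Psi ρ₀ (R.x k ω)) μ := by
  obtain ⟨C, hC⟩ := hK.exists_bound_of_continuousOn (hQ.continuous_Psi ρ₀).continuousOn
  exact Integrable.of_bound
    ((hR.measurable_Psi hQ hA k).mono (R.past_le k) le_rfl).aestronglyMeasurable C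
    (ae_of_all _ fun ω => hC _ (hst.1 k ω))

theorem integrable_stationarity [IsFiniteMeasure μ] (hR : R.SufficientReduction) (hQ : Q.IsC1)
    (hA : R.Adapted) (hK : IsCompact K) (hst : R.StaysIn K Ω) (k : ℕ) :
    Integrable (fun ω => Q.phi (R.x k ω) ^ 2 + Q.chi A.βl (R.x k ω) ^ 2) μ := by
  obtain ⟨C, hC⟩ := hQ.exists_stationarity_le (βl := A.βl) hK (by linarith [A.βl_gt, A.σu_pos])
  refine Integrable.of_bound
    ((hR.measurable_stationarity hQ hA k).mono (R.past_le k) le_rfl).aestronglyMeasurable C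
    (ae_of_all _ fun ω => ?_)
  rw [Real.norm_of_nonneg (by positivity)]
  exact hC _ (hst.1 k ω)

theorem integrable_alpha_mul_stationarity [IsFiniteMeasure μ] (hR : R.SufficientReduction)
    (hQ : Q.IsC1) (hA : R.Adapted) (hK : IsCompact K) (hst : R.StaysIn K Ω) (k : ℕ) :
    Integrable (fun ω => R.α k ω * (Q.phi (R.x k ω) ^ 2 + Q.chi A.βl (R.x k ω) ^ 2)) μ := by
  refine (hR.integrable_stationarity hQ hA hK hst k).bdd_mul (c := A.αmax)
    ((hR.measurable_alpha hQ hA k).mono (R.past_le k) le_rfl).aestronglyMeasurable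
    (ae_of_all _ fun ω => ?_)
  rw [Real.norm_of_nonneg (hR.alpha_pos k ω).le]
  exact hR.alpha_le k ω

theorem integrable_estimateError (hR : R.SufficientReduction) (hQ : Q.IsC1) (hA : R.Adapted)
    [IsFiniteMeasure μ] {κf : ℝ} (hV : R.VarianceCond μ κf) (k : ℕ) :
    Integrable (R.estimateError εf k) μ :=
  have hJ := (hR.measurableSet_funEvent hQ hA εf k).compl
  (((hV k).2.1.integrable one_le_two).abs.indicator hJ).add
    (((hV k).1.1.integrable one_le_two).abs.indicator hJ)

theorem condExp_estimateError_le [IsFiniteMeasure μ] (hR : R.SufficientReduction) (hQ : Q.IsC1)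
    (hA : R.Adapted) (hK : IsCompact K) (hst : R.StaysIn K Ω) {κf pf : ℝ} (hκf : 0 ≤ κf)
    (hF : R.FunAccurate μ εf pf) (hV : R.VarianceCond μ κf) (k : ℕ) :
    ∀ᵐ ω ∂μ, (μ[R.estimateError εf k | R.past k]) ω ≤ 2 * κf * √(1 - pf) *
      (R.α k ω * (Q.phi (R.x k ω) ^ 2 + Q.chi A.βl (R.x k ω) ^ 2)) := by
  set Z : S → ℝ := fun ω =>
    κf * (R.α k ω * (Q.phi (R.x k ω) ^ 2 + Q.chi A.βl (R.x k ω) ^ 2)) with hZ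
  have hZm : Measurable[R.past k] Z :=
    ((hR.measurable_alpha hQ hA k).mul (hR.measurable_stationarity hQ hA k)).const_mul κf
  have hZi : Integrable Z μ :=
    (hR.integrable_alpha_mul_stationarity hQ hA hK hst k).const_mul κf
  have hZ₀ : 0 ≤ Z := fun ω =>
    mul_nonneg hκf (mul_nonneg (hR.alpha_pos k ω).le (by positivity))
  have hZsq (ω : S) : κf ^ 2 * R.α k ω ^ 2 *
      (Q.phi (R.x k ω) ^ 2 + Q.chi A.βl (R.x k ω) ^ 2) ^ 2 = Z ω ^ 2 := by rw [hZ]; ring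
  have hJ := hR.measurableSet_funEvent hQ hA εf k
  have hpart {X : S → ℝ} (hX : MemLp X 2 μ)
      (hXv : ∀ᵐ ω ∂μ, (μ[fun ω => |X ω| ^ 2 | R.pastHalf k]) ω ≤ κf ^ 2 * R.α k ω ^ 2 *
        (Q.phi (R.x k ω) ^ 2 + Q.chi A.βl (R.x k ω) ^ 2) ^ 2) :
      μ[(R.funEvent εf k)ᶜ.indicator fun ω => |X ω| | R.past k] ≤ᵐ[μ]
        fun ω => √(1 - pf) * Z ω :=
    condExp_indicator_compl_abs_le_of_le (R.past_le_pastHalf k) (R.pastHalf_le k) hJ (hF k) hX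
      hZm hZi hZ₀ (hXv.mono fun ω hω => hω.trans_eq (hZsq ω))
  filter_upwards [hpart (hV k).2.1 (hV k).2.2, hpart (hV k).1.1 (hV k).1.2,
    condExp_add (((hV k).2.1.integrable one_le_two).abs.indicator hJ.compl)
      (((hV k).1.1.integrable one_le_two).abs.indicator hJ.compl) (R.past k)] with ω h0 hs hadd
  rw [estimateError, hadd, Pi.add_apply]
  linarith

theorem levelProcess [IsFiniteMeasure μ] (hR : R.SufficientReduction) {κf pf pg : ℝ}
    (hS : R.StandingAssumptions μ K Ω ξ MH κg εf κf pf pg) (hΩ : Q.RegularOn Ω Lf Lh Lc)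
    (hK : IsCompact K) (hρ : 0 ≤ ρ₀) (hξ : 0 < ξ) (hκg : 0 ≤ κg) (hε₀ : 0 ≤ εf)
    (hεf : 4 * A.αmax * εf ≤ ξ * A.θ) (hκf : 0 ≤ κf) (hpf : 0 ≤ pf) {C : ℝ} (hC : 0 < C)
    (hCe : ∀ k, ∀ ω ∈ R.gradEvent κg k,
      Q.phi (R.x k ω) ^ 2 + Q.chi A.βl (R.x k ω) ^ 2 ≤ C * ‖R.d k ω‖ ^ 2)
    {m : ℕ} (hm₀ : A.j₀ ≤ m) (hm₁ : A.αmax / A.γ ^ m ≤ 1)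
    (hm : A.αmax / A.γ ^ m * (κg + Lf + 2 * εf + ρ₀ * Lhc Lh Lc) ≤ (1 - A.θ) * ξ)
    {Ψmin : ℝ} (hΨ : ∀ x ∈ Ω, Ψmin ≤ Q.Psi ρ₀ x) :
    LevelProcess μ R.pastFiltration (fun i => A.αmax / A.γ ^ i) m (A.θ * ξ / (2 * C)) (pf * pg)
      (2 * κf * √(1 - pf)) (fun k ω => Q.Psi ρ₀ (R.x k ω) - Ψmin)
      (fun k ω => Q.phi (R.x k ω) ^ 2 + Q.chi A.βl (R.x k ω) ^ 2) (R.estimateError εf) R.level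
      (fun k => R.gradEvent κg k ∩ R.funEvent εf k) where
  antitone i j hij := div_le_div_of_nonneg_left A.αmax_pos.le
    (pow_pos (one_pos.trans A.γ_gt) _) (pow_le_pow_right₀ A.γ_gt.le hij)
  size_pos i := div_pos A.αmax_pos (pow_pos (one_pos.trans A.γ_gt) i)
  rate_pos := div_pos (mul_pos A.θ_pos hξ) (mul_pos two_pos hC)
  measurable_merit k := (hR.measurable_Psi hΩ.isC1 hS.adapted k).sub_const _
  measurable_stat := hR.measurable_stationarity hΩ.isC1 hS.adapted
  measurable_lev := hR.measurable_level hΩ.isC1 hS.adapted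
  measurableSet_good k :=
    (R.pastHalf_le k _ (hR.measurableSet_gradEvent hΩ.isC1 hS.adapted κg k)).inter
      (hR.measurableSet_funEvent hΩ.isC1 hS.adapted εf k)
  integrable_merit k :=
    (hR.integrable_Psi hΩ.isC1 hS.adapted hK hS.staysIn k).sub (integrable_const _)
  integrable_stat := hR.integrable_stationarity hΩ.isC1 hS.adapted hK hS.staysIn
  integrable_err := hR.integrable_estimateError hΩ.isC1 hS.adapted hS.varianceCond
  merit_nonneg k ω := by
    have hx := hS.staysIn.2 k ω 0 ⟨le_rfl, (hR.alpha_pos k ω).le⟩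
    rw [zero_smul, add_zero] at hx
    exact sub_nonneg.2 (hΨ _ hx)
  stat_nonneg k ω := by positivity
  err_nonneg := R.estimateError_nonneg εf
  lev_zero_le _ := hm₀
  le_prob_good k := mul_le_condExp_indicator_inter (R.past_le_pastHalf k) (R.pastHalf_le k)
    (hR.measurableSet_gradEvent hΩ.isC1 hS.adapted κg k)
    (hR.measurableSet_funEvent hΩ.isC1 hS.adapted εf k) hpf
    (by simpa only [hS.pg_eq] using hS.gradAccurate k) (hS.funAccurate k)
  condExp_err_le k := by
    simp only [← hR.alpha_eq]
    exact hR.condExp_estimateError_le hΩ.isC1 hS.adapted hK hS.staysIn hκf hS.funAccurate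
      hS.varianceCond k
  step k ω := by
    rw [← hR.alpha_eq, level]
    split_ifs with hs
    · right
      refine ⟨rfl, ?_, fun hgood => ?_⟩
      · linarith [hR.Psi_succ_le_add_estimateError hS.hessianBounds hξ.le hε₀ hεf hs]
      · linarith [hR.Psi_succ_le_sub hS.hessianBounds hξ.le hε₀ hεf hs hgood.2 hC
          (hCe k ω hgood.1)]
    · left
      rw [(hR.step_of_notMem hs).1]
      exact ⟨rfl, rfl, rfl,
        hR.level_lt_of_notMem_successEvent hΩ hS.staysIn hS.hessianBounds hρ hκg hε₀ hm₁ hm hs⟩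

theorem lintegral_hitTime_le [IsProbabilityMeasure μ] (hR : R.SufficientReduction)
    {κf pf pg : ℝ} (hS : R.StandingAssumptions μ K Ω ξ MH κg εf κf pf pg)
    (hΩ : Q.RegularOn Ω Lf Lh Lc) (hK : IsCompact K) (hρ : 0 ≤ ρ₀) (hξ : 0 < ξ) (hκg : 0 ≤ κg)
    (hε₀ : 0 ≤ εf) (hεf : 4 * A.αmax * εf ≤ ξ * A.θ) (hκf : 0 ≤ κf) (hpf : 0 ≤ pf)
    {C : ℝ} (hC : 0 < C) (hCe : ∀ k, ∀ ω ∈ R.gradEvent κg k,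
      Q.phi (R.x k ω) ^ 2 + Q.chi A.βl (R.x k ω) ^ 2 ≤ C * ‖R.d k ω‖ ^ 2)
    {m : ℕ} (hm₀ : A.j₀ ≤ m) (hm₁ : A.αmax / A.γ ^ m ≤ 1)
    (hm : A.αmax / A.γ ^ m * (κg + Lf + 2 * εf + ρ₀ * Lhc Lh Lc) ≤ (1 - A.θ) * ξ)
    (hp : 3 / 4 ≤ pf * pg) {v : ℝ} (hv : 0 < v)
    (hvC : v * 4 ^ (m + 1) ≤ A.θ * ξ / (2 * C) * (A.αmax / A.γ ^ m))
    (hκv : 2 * κf * √(1 - pf) * A.αmax ≤ v) {Ψmin : ℝ} (hΨ : ∀ x ∈ Ω, Ψmin ≤ Q.Psi ρ₀ x)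
    {ε : ℝ} (hε : 0 < ε) :
    ∫⁻ ω, R.hitTime ε ω ∂μ ≤ ENNReal.ofReal (2 * (Q.Psi ρ₀ x₀ - Ψmin) / (v * ε)) := by
  have hbound := (hR.levelProcess hS hΩ hK hρ hξ hκg hε₀ hεf hκf hpf hC hCe hm₀ hm₁ hm
    hΨ).lintegral_hit_le hp hv hvC hε (by positivity) (by rwa [pow_zero, div_one])
  simpa only [hitTime, R.x_zero, integral_const, probReal_univ, one_smul] using hbound

end SufficientReduction

end LevelProcess

end Run

/-! ### Complexity -/

section Constants

theorem exists_ge_div_pow_le {γ δ : ℝ} (hγ : 1 < γ) (hδ : 0 < δ) (a : ℝ) (j : ℕ) :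
    ∃ m, j ≤ m ∧ a / γ ^ m ≤ δ := by
  have hlim : Tendsto (fun m : ℕ => a / γ ^ m) atTop (𝓝 0) :=
    tendsto_const_nhds.div_atTop (tendsto_pow_atTop_atTop_of_one_lt hγ)
  exact ((eventually_ge_atTop j).and (hlim.eventually (Iic_mem_nhds hδ))).exists

theorem exists_lt_one_forall_mul_one_sub_le (a₁ a₂ : ℝ) {b₁ b₂ : ℝ} (hb₁ : 0 < b₁)
    (hb₂ : 0 < b₂) : ∃ νs : ℝ, 0 < νs ∧ νs < 1 ∧ ∀ ν, νs ≤ ν → ν < 1 →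
      a₁ * (1 - ν) ≤ b₁ * ν ∧ a₂ * (1 - ν) ≤ b₂ * ν := by
  set r : ℝ := max 1 (max (a₁ / b₁) (a₂ / b₂))
  have : 0 < r := one_pos.trans_le (le_max_left _ _)
  have key {a b ν : ℝ} (hb : 0 < b) (hab : a / b ≤ r) (hν : r / (1 + r) ≤ ν) (hν₁ : ν < 1) :
      a * (1 - ν) ≤ b * ν := by
    rw [div_le_iff₀ (by positivity)] at hν
    calc a * (1 - ν) ≤ r * b * (1 - ν) :=
          mul_le_mul_of_nonneg_right ((div_le_iff₀ hb).1 hab) (sub_nonneg.2 hν₁.le)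
      _ = b * (r * (1 - ν)) := by ring
      _ ≤ b * ν := mul_le_mul_of_nonneg_left (by linarith) hb.le
  exact ⟨r / (1 + r), by positivity, (div_lt_one (by positivity)).2 (by linarith),
    fun ν hν hν₁ => ⟨key hb₁ ((le_max_left _ _).trans (le_max_right _ _)) hν hν₁,
      key hb₂ ((le_max_right _ _).trans (le_max_right _ _)) hν hν₁⟩⟩

variable {γ ν κ p q s : ℝ}

theorem ten_elevenths_le_div (hγ : 1 < γ) :
    10 / 11 ≤ (2 * γ - 1) / (2 * γ - 1 / 2 * γ⁻¹ - 1 / 2) := by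
  have : 0 < γ := one_pos.trans hγ
  have hinv₁ : γ⁻¹ < 1 := inv_lt_one_of_one_lt₀ hγ
  have hnonneg : 0 ≤ γ⁻¹ * ((2 * γ - 3) ^ 2 + 1) := by positivity
  have hexpand : γ⁻¹ * ((2 * γ - 3) ^ 2 + 1) = 4 * γ - 12 + 10 * γ⁻¹ := by
    field_simp
    ring
  rw [div_le_div_iff₀ (by norm_num) (by linarith)]
  linarith

theorem mul_le_of_accuracy (hγ : 1 < γ) (hν₁ : ν < 1) (hq : 0 < q) (hpq : p * q ≤ 1)
    (h : 8 * ((1 - ν) * (γ - 1) + 2 * ν * κ) / (q * (1 - γ⁻¹) * (1 - ν)) * s ≤ p) :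
    8 * ((1 - ν) * (γ - 1) + 2 * ν * κ) * s ≤ (1 - γ⁻¹) * (1 - ν) := by
  have hγi : 0 < 1 - γ⁻¹ := sub_pos.2 (inv_lt_one_of_one_lt₀ hγ)
  have hνpos : 0 < 1 - ν := sub_pos.2 hν₁
  rw [div_mul_eq_mul_div, div_le_iff₀ (by positivity)] at h
  calc _ ≤ p * q * ((1 - γ⁻¹) * (1 - ν)) := by linarith
    _ ≤ _ := mul_le_of_le_one_left (by positivity) hpq

theorem le_one_eighth_of_accuracy (hγ : 1 < γ) (hν₀ : 0 ≤ ν) (hν₁ : ν < 1) (hκ : 0 ≤ κ)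
    (hq : 0 < q) (hpq : p * q ≤ 1) (hs : 0 ≤ s)
    (h : 8 * ((1 - ν) * (γ - 1) + 2 * ν * κ) / (q * (1 - γ⁻¹) * (1 - ν)) * s ≤ p) :
    s ≤ 1 / 8 := by
  have : 0 < γ := one_pos.trans hγ
  have hγi : 1 - γ⁻¹ ≤ γ - 1 := by
    calc 1 - γ⁻¹ = (γ - 1) / γ := by field_simp
      _ ≤ γ - 1 := div_le_self (by linarith) hγ.le
  have hpos : 0 < (γ - 1) * (1 - ν) := mul_pos (sub_pos.2 hγ) (sub_pos.2 hν₁)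
  refine le_of_mul_le_mul_right ?_ hpos
  have : 0 ≤ ν * κ * s := by positivity
  linarith [mul_le_of_accuracy hγ hν₁ hq hpq h,
    mul_le_mul_of_nonneg_right hγi (sub_nonneg.2 hν₁.le)]

theorem mul_le_one_sub_of_accuracy (hγ : 1 < γ) (hν₁ : ν < 1) (hq : 0 < q)
    (hpq : p * q ≤ 1) (hs : 0 ≤ s)
    (h : 8 * ((1 - ν) * (γ - 1) + 2 * ν * κ) / (q * (1 - γ⁻¹) * (1 - ν)) * s ≤ p) :
    16 * (ν * (κ * s)) ≤ 1 - ν := by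
  have hγi : 0 ≤ γ⁻¹ * (1 - ν) :=
    mul_nonneg (inv_nonneg.2 (one_pos.trans hγ).le) (sub_nonneg.2 hν₁.le)
  have : 0 ≤ (1 - ν) * (γ - 1) * s :=
    mul_nonneg (mul_nonneg (sub_nonneg.2 hν₁.le) (sub_nonneg.2 hγ.le)) hs
  linarith [mul_le_of_accuracy hγ hν₁ hq hpq h]

theorem two_mul_mul_le_of_accuracy {a v : ℝ} (hγ : 1 < γ) (hν₀ : 0 < ν) (hν₁ : ν < 1)
    (hq : 0 < q) (hpq : p * q ≤ 1) (hs : 0 ≤ s)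
    (h : 8 * ((1 - ν) * (γ - 1) + 2 * ν * κ) / (q * (1 - γ⁻¹) * (1 - ν)) * s ≤ p)
    (ha : 0 ≤ a) (hav : a * (1 - ν) ≤ 8 * v * ν) : 2 * κ * s * a ≤ v := by
  refine le_of_mul_le_mul_right ?_ hν₀
  linarith [mul_le_mul_of_nonneg_left (mul_le_one_sub_of_accuracy hγ hν₁ hq hpq hs h) ha]

theorem three_quarters_le_mul (hs : √(1 - p) ≤ 1 / 8) (hq : 10 / 11 ≤ q) :
    3 / 4 ≤ p * q := by
  have hp' : 63 / 64 ≤ p := by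
    have := (Real.sqrt_le_left (by norm_num)).1 hs
    linarith
  calc (3 / 4 : ℝ) ≤ 63 / 64 * (10 / 11) := by norm_num
    _ ≤ p * q := mul_le_mul hp' hq (by norm_num) (by linarith)

theorem exists_lt_one_forall_accuracy_bounds {a v b : ℝ} (G : ℝ) (hγ : 1 < γ) (ha : 0 ≤ a)
    (hv : 0 < v) (hb : 0 < b) : ∃ νs : ℝ, 0 < νs ∧ νs < 1 ∧ ∀ ν, νs ≤ ν → ν < 1 →
      G * (1 - ν) ≤ b * ν ∧ ∀ κ p q : ℝ, 0 ≤ κ → 0 < q → p * q ≤ 1 →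
        (2 * γ - 1) / (2 * γ - 1 / 2 * γ⁻¹ - 1 / 2) ≤ q →
        8 * ((1 - ν) * (γ - 1) + 2 * ν * κ) / (q * (1 - γ⁻¹) * (1 - ν)) * √(1 - p) ≤ p →
        3 / 4 ≤ p * q ∧ 2 * κ * √(1 - p) * a ≤ v := by
  obtain ⟨νs, hνs₀, hνs₁, hνs⟩ := exists_lt_one_forall_mul_one_sub_le a G
    (mul_pos (by norm_num : (0 : ℝ) < 8) hv) hb
  refine ⟨νs, hνs₀, hνs₁, fun ν hν hν₁ => ⟨(hνs ν hν hν₁).2, fun κ p q hκ hq hpq hγq hacc => ?_⟩⟩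
  have hν₀ := hνs₀.trans_le hν
  exact ⟨three_quarters_le_mul
    (le_one_eighth_of_accuracy hγ hν₀.le hν₁ hκ hq hpq (Real.sqrt_nonneg _) hacc)
    ((ten_elevenths_le_div hγ).trans hγq), two_mul_mul_le_of_accuracy hγ hν₀ hν₁ hq hpq
      (Real.sqrt_nonneg _) hacc ha (hνs ν hν hν₁).1⟩

theorem two_mul_div_le_complexity {θ ξ N U M v ε : ℝ} (hpq : p * q ≤ 1) (hp : 1 / 2 < p * q)
    (hν₀ : 0 ≤ ν) (hν₁ : ν < 1) (hγ : 1 < γ) (hθ : θ < 1) (hξ : 0 < ξ) (hN : 0 ≤ N) (hv : 0 < v)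
    (hNv : (1 - γ⁻¹) * (1 - θ) * ξ * (1 - ν) ≤ 2 * N * v * ν) (hε : 0 < ε) (hU : 0 ≤ U)
    (hM : ν * U ≤ M) : 2 * U / (v * ε) ≤
      1 / (2 * p * q - 1) * (4 * N / ((1 - ν) * (1 - γ⁻¹) * (1 - θ) * ξ * ε)) * M := by
  have hM₀ : 0 ≤ M := (mul_nonneg hν₀ hU).trans hM
  have hr : 1 ≤ 1 / (2 * p * q - 1) := (one_le_div (by linarith)).2 (by linarith)
  set D : ℝ := (1 - ν) * (1 - γ⁻¹) * (1 - θ) * ξ * ε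
  have hD : 0 < D := mul_pos (mul_pos (mul_pos (mul_pos (sub_pos.2 hν₁)
    (sub_pos.2 (inv_lt_one_of_one_lt₀ hγ))) (sub_pos.2 hθ)) hξ) hε
  have hDN : D ≤ 2 * N * v * ν * ε := by linarith [mul_le_mul_of_nonneg_right hNv hε.le]
  calc 2 * U / (v * ε) ≤ 4 * N / D * (ν * U) := by
        rw [div_mul_eq_mul_div, div_le_div_iff₀ (by positivity) hD]
        linarith [mul_le_mul_of_nonneg_left hDN (mul_nonneg zero_le_two hU)]
    _ ≤ 4 * N / D * M := by gcongr
    _ ≤ 1 / (2 * p * q - 1) * (4 * N / D) * M := by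
        rw [mul_assoc]
        exact le_mul_of_one_le_left (by positivity) hr

end Constants

section Complexity

variable {n m₁ m₂ : ℕ} {Q : Problem n m₁ m₂} {A : Params} {Ω K : Set (E n)} {Lf : NNReal}
  {Lh : Fin m₁ → NNReal} {Lc : Fin m₂ → NNReal} {ξ MH κg εf : ℝ}

theorem Params.βu_pos (A : Params) : 0 < A.βu := by linarith [A.βl_gt, A.σu_pos, A.βu_gt]

theorem mul_le_merit₀ (Q : Problem n m₁ m₂) (A : Params) (x₀ : E n) (ρ Ψmin : ℝ) {ν : ℝ}
    (hν : ν ≤ 1) : ν * (Q.Psi ρ x₀ - Ψmin) ≤ merit₀ Q A x₀ ρ ν Ψmin := by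
  have hα₀ : 0 ≤ A.α₀ := div_nonneg A.αmax_pos.le (pow_nonneg (one_pos.trans A.γ_gt).le _)
  have : 0 ≤ (1 - ν) * A.α₀ * (Q.phi x₀ ^ 2 + Q.chi A.βl x₀ ^ 2) :=
    mul_nonneg (mul_nonneg (sub_nonneg.2 hν) hα₀) (by positivity)
  unfold merit₀
  linarith

theorem Run.StandingAssumptions.mem {S : Type*} [MeasurableSpace S] {μ : Measure S} [NeZero μ]
    {x₀ : E n} {ρ₀ p₀ κf pf pg : ℝ} {R : Run Q A x₀ ρ₀ p₀ S}
    (hS : R.StandingAssumptions μ K Ω ξ MH κg εf κf pf pg) : x₀ ∈ K := by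
  obtain ⟨ω⟩ := μ.nonempty_of_neZero
  simpa only [R.x_zero] using hS.staysIn.1 0 ω

theorem Problem.RegularOn.exists_lintegral_hitTime_le (hΩ : Q.RegularOn Ω Lf Lh Lc)
    (A : Params) (hK : IsCompact K) (hMF : ∀ x ∈ K, Q.EMFCQ x) (hξ : 0 < ξ) (hMH : 0 ≤ MH)
    (hκg : 0 < κg) (hε₀ : 0 ≤ εf) (hεf : εf ≤ ξ * A.θ / (4 * A.αmax)) :
    ∃ ρs : ℝ, 0 < ρs ∧ ∀ ρ, ρs < ρ → ∃ v : ℝ, 0 < v ∧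
      ∀ κf pf pg : ℝ, 0 ≤ κf → 0 ≤ pf → 3 / 4 ≤ pf * pg →
        2 * κf * √(1 - pf) * A.αmax ≤ v →
      ∀ (S : Type*) [MeasurableSpace S] (μ : Measure S) [IsProbabilityMeasure μ] (x₀ : E n)
        (p₀ : ℝ) (R : Run Q A x₀ ρ p₀ S), R.StandingAssumptions μ K Ω ξ MH κg εf κf pf pg →
      ∀ Ψmin : ℝ, (∀ x ∈ Ω, Ψmin ≤ Q.Psi ρ x) → ∀ ε : ℝ, 0 < ε →
        ∫⁻ ω, R.hitTime ε ω ∂μ ≤ ENNReal.ofReal (2 * (Q.Psi ρ x₀ - Ψmin) / (v * ε)) := by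
  obtain ⟨ρs, hρs, hpenalty⟩ := hΩ.isC1.exists_penalty A hK hMF hMH
  obtain ⟨C, hC, hstationarity⟩ := hΩ.isC1.exists_stationarity_le_mul_sq A hK hMF hMH
    (mul_nonneg hκg.le A.αmax_pos.le)
  have hεθ : 4 * A.αmax * εf ≤ ξ * A.θ := by
    rwa [mul_comm, ← le_div_iff₀ (mul_pos four_pos A.αmax_pos)]
  refine ⟨ρs, hρs, fun ρ hρ => ?_⟩
  have hρ₀ : 0 ≤ ρ := (hρs.trans hρ).le
  have hM : 0 < κg + Lf + 2 * εf + ρ * Lhc Lh Lc := by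
    have : 0 ≤ Lhc Lh Lc := NNReal.coe_nonneg _
    positivity
  obtain ⟨m, hm₀, hm⟩ := exists_ge_div_pow_le A.γ_gt
    (lt_min one_pos (div_pos (mul_pos (sub_pos.2 A.θ_lt) hξ) hM)) A.αmax A.j₀
  have hpos : 0 < A.θ * ξ / (2 * C) * (A.αmax / A.γ ^ m) :=
    mul_pos (div_pos (mul_pos A.θ_pos hξ) (by positivity))
      (div_pos A.αmax_pos (pow_pos (one_pos.trans A.γ_gt) _))
  refine ⟨A.θ * ξ / (2 * C) * (A.αmax / A.γ ^ m) / 4 ^ (m + 1), by positivity, ?_⟩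
  intro κf pf pg hκf hpf hp hκv S _ μ _ x₀ p₀ R hS Ψmin hΨ ε hε
  have hH (k : ℕ) (ω : S) (w : E n) : quad (R.H k ω) w ≤ MH * ‖w‖ ^ 2 :=
    (hS.hessianBounds k ω w).2
  have hg := R.norm_g_le hS.threshold_eq
  have hR : R.SufficientReduction := fun k ω => hpenalty _ (hS.staysIn.1 k ω) _ _ _ _ _ (hg k ω)
    (hH k ω) (R.β_mem k ω).1 (R.isQPSolution k ω) hρ.le
  refine hR.lintegral_hitTime_le hS hΩ hK hρ₀ hξ hκg.le hε₀ hεθ hκf hpf hC (fun k ω hω => ?_)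
    hm₀ (hm.trans (min_le_left _ _)) ((le_div_iff₀ hM).1 (hm.trans (min_le_right _ _))) hp
    (by positivity) (div_mul_cancel₀ _ (by positivity)).le hκv hΨ hε
  refine hstationarity _ (hS.staysIn.1 k ω) _ _ _ _ (fun w => ⟨?_, hH k ω w⟩) (R.β_mem k ω)
    (R.isQPSolution k ω) (le_trans hω ?_)
  · exact le_trans (by positivity) (hS.hessianBounds k ω w).1
  · gcongr
    exact hR.alpha_le k ω

end Complexity

end StochSQP

theorem mainTheorem3 {n m₁ m₂ : ℕ}
    (Q : StochSQP.Problem n m₁ m₂) (A : StochSQP.Params)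
    (Ω K : Set (StochSQP.E n))
    (Lf : NNReal) (Lh : Fin m₁ → NNReal) (Lc : Fin m₂ → NNReal)
    (hΩ : Q.RegularOn Ω Lf Lh Lc)
    (hK : IsClosed K) (hKΩ : K ⊆ Ω) (hMF : ∀ x ∈ K, Q.EMFCQ x)
    (ξ MH κg εf : ℝ) (hξ : 0 < ξ) (hMH : 0 < MH) (hκg : 0 < κg) (hεf : 0 < εf)
    (hεf' : εf < ξ * A.θ / (4 * A.αmax)) :
    ∃ ρstar : ℝ, 0 < ρstar ∧ ∀ ρbar : ℝ, ρstar < ρbar →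
    ∃ νstar : ℝ, 0 < νstar ∧ νstar < 1 ∧ ∀ ν : ℝ, νstar ≤ ν → ν < 1 →
    ∀ κf pf pg : ℝ, 0 < κf → 0 < pf → pf ≤ 1 → 0 < pg → pg ≤ 1 →
      (2 * A.γ - 1) / (2 * A.γ - 1 / 2 * A.γ⁻¹ - 1 / 2) ≤ pg →
      8 * ((1 - ν) * (A.γ - 1) + 2 * ν * κf) / (pg * (1 - A.γ⁻¹) * (1 - ν))
          * Real.sqrt (1 - pf) ≤ pf →
      1 / 2 ≤ pf * pg →
    ∀ (S : Type*) [MeasurableSpace S] (μ : MeasureTheory.Measure S)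
      [MeasureTheory.IsProbabilityMeasure μ]
      (x₀ : StochSQP.E n) (R : StochSQP.Run Q A x₀ ρbar pg S),
      R.Adapted → R.StaysIn K Ω → R.HessianBounds ξ MH →
      (∀ k ω, R.ζ k ω = A.ζ₀ ∧ R.pg k ω = pg) →
      R.GradAccurate μ κg → R.FunAccurate μ εf pf → R.VarianceCond μ κf →
    ∀ Ψmin : ℝ, (∀ x ∈ Ω, Ψmin ≤ Q.Psi ρbar x) →
    ∀ ε : ℝ, 0 < ε →
      ∫⁻ ω, R.hitTime ε ω ∂μ ≤
        ENNReal.ofReal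
          (1 / (2 * pf * pg - 1)
            * (4 * (κg * A.βu + 1 / 2 * Lf + 2 * εf + 1 / 2 * ρbar * StochSQP.Lhc Lh Lc)
                / ((1 - ν) * (1 - A.γ⁻¹) * (1 - A.θ) * ξ * ε))
            * StochSQP.merit₀ Q A x₀ ρbar ν Ψmin + 1) := by
  obtain ⟨ρs, hρs, hbound⟩ := hΩ.exists_lintegral_hitTime_le A
    (Metric.isCompact_of_isClosed_isBounded hK (hΩ.bounded.subset hKΩ)) hMF hξ hMH.le hκg hεf.le
    hεf'.le
  refine ⟨ρs, hρs, fun ρ hρ => ?_⟩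
  obtain ⟨v, hv, hT⟩ := hbound ρ hρ
  set N : ℝ := κg * A.βu + 1 / 2 * Lf + 2 * εf + 1 / 2 * ρ * StochSQP.Lhc Lh Lc
  have hN : 0 < N := by
    have := hρs.trans hρ
    have := A.βu_pos
    have : 0 ≤ StochSQP.Lhc Lh Lc := NNReal.coe_nonneg _
    positivity
  obtain ⟨νs, hνs₀, hνs₁, hνs⟩ := StochSQP.exists_lt_one_forall_accuracy_bounds
    ((1 - A.γ⁻¹) * (1 - A.θ) * ξ) A.γ_gt A.αmax_pos.le hv (by positivity : 0 < 2 * N * v)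
  refine ⟨νs, hνs₀, hνs₁, fun ν hν hν₁ κf pf pg hκf hpf₀ hpf₁ hpg₀ hpg₁ hpg hacc _ S _ μ _ x₀ R hA
    hst hH hζ hG hF hV Ψmin hΨ ε hε => ?_⟩
  have hpq : pf * pg ≤ 1 := mul_le_one₀ hpf₁ hpg₀.le hpg₁
  obtain ⟨hp, hκv⟩ := (hνs ν hν hν₁).2 κf pf pg hκf.le hpg₀ hpq hpg hacc
  have hS : R.StandingAssumptions μ K Ω ξ MH κg εf κf pf pg :=
    ⟨hA, hst, hH, fun k ω => (hζ k ω).1, fun k ω => (hζ k ω).2, hG, hF, hV⟩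
  refine (hT κf pf pg hκf.le hpf₀.le hp hκv S μ x₀ pg R hS Ψmin hΨ ε hε).trans
    (ENNReal.ofReal_le_ofReal ?_)
  exact (StochSQP.two_mul_div_le_complexity hpq (by linarith) (hνs₀.le.trans hν) hν₁ A.γ_gt A.θ_lt
    hξ hN.le hv (hνs ν hν hν₁).1 hε (sub_nonneg.2 (hΨ x₀ (hKΩ hS.mem)))
    (StochSQP.mul_le_merit₀ Q A x₀ ρ Ψmin hν₁.le)).trans (le_add_of_nonneg_right zero_le_one)
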